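/- Let $d\ge 2$. For a polytope $P\subset\mathbb R^d$ of volume $1$ let $F(P)$ be the number of flags of $P$ (chains $F_0\subset F_1\subset\dots\subset F_{d-1}$ of faces of $P$ with $\dim F_i=i$). Write $V$ for volume and $v(z)=\min\{V(P\cap H): H \text{ a closed half-space},\ z\in H\}$ for $z\in P$, and put $P(v\ge t)=\{z\in P: v(z)\ge t\}$, $P(v\le t)=\{z\in P:v(z)\le t\}$, $P(v=t)=\partial P(v\ge t)$. With $h_P(u)=\max_{x\in P}u\cdot x$, a cap of $P$ is a set $C=P\cap\{x: u\cdot x\ge h_P(u)-t\}$ with $|u|=1$, and $C^\lambda=P\cap\{x:u\cdot x\ge h_P(u)-\lambda t\}$ for $\lambda>0$; a minimal cap $C(z)$ of $z\in P$ is a cap containing $z$ with $V(C(z))=v(z)$. Let $M(z,\lambda)=z+\lambda[(P-z)\cap(z-P)]$ be the Macbeath regions. Put $$\alpha=(6d)^d(4d^2+d-1),\quad \beta=4d^2+d-1,\quad \gamma=3d^36^d,\quad T=\frac{\alpha\ln\ln\eta}{\eta},\quad T^*=d6^dT,\quad s=\frac1{\eta\ln^\beta\eta}.$$ Let $y_1,\dots,y_m$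 be a saturated system on $P(v=T)$, that is, a maximal system of points of $P(v=T)$ whose Macbeath regions $M(y_j,\frac12)$ are pairwise disjoint; fix minimal caps $C(y_j)$ and put $K'_j=M(y_j,\frac12)\cap C(y_j)$ (half Macbeath regions), $K_j=C(y_j)^6$, $K_j^\gamma=C(y_j)^{6\gamma}$. Let $S_1,\dots,S_m$ be closed sets with pairwise disjoint interiors such that $\bigcup_j S_j=P$, $K'_j\subset S_j$ and $S_j\cap P(v\le T^*)\subset K_j^\gamma$, and put $S'_j=S_j\cap P(v\le T^*)$. Let $X$ be a Poisson point process in $\mathbb R^d$ of intensity $\eta$, and let $\Pi_\eta$ be the convex hull of $X\cap P$. Let $A$ be the event that every $K'_j$ contains at least one point of $X$, that $P(v\le s)$ contains no point of $X$, and that each $S'_j$ contains at most $3(6\gamma)^d\alpha\ln\ln\eta$ points of $X$ $(j=1,\dots,m)$; let $\overline A$ be its complement. Then there are constants $c_1,c_2,c_3>0$ and $\eta_0>1$, depending only on $d$, such that for every polytope $P\subset\mathbb R^d$ of volume $1$, every $\eta\ge\eta_0$, and all choices of the $y_j$, $C(y_j)$, $S_j$ and $X$ as above, $$c_1\ln^{-(3d)^{d+2}}\eta\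 \le\ \mathbb P(\overline A)\ \le\ c_2\,F(P)\ln^{-4d^2}\eta ,$$ and whenever $A$ occurs, $$P(v\ge T^*)\subset\Pi_\eta\subset P(v\ge s)\qquad\text{and}\qquad |P(v\le T^*)\cap X|\ \le\ c_3\,F(P)\,\ln^{d-1}\eta\,\ln\ln\eta .$$ -/

import Mathlib

open MeasureTheory ProbabilityTheory Set
open scoped RealInnerProductSpace NNReal ENNReal

noncomputable section

namespace PoissonPolytope

/-- Euclidean `d`-space, with its Euclidean inner product and Lebesgue measure. -/
abbrev Pt (d : ℕ) : Type := EuclideanSpace ℝ (Fin d)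

/-! ### Convex geometry -/

section Geometry

variable {d : ℕ}

/-- A polytope: the convex hull of finitely many points. -/
def IsPolytope (P : Set (Pt d)) : Prop :=
  ∃ V : Set (Pt d), V.Finite ∧ P = convexHull ℝ V

/-- A flag of `P`: faces `F 0 ⊆ F 1 ⊆ ⋯ ⊆ F (d - 1)` of `P` with `dim (F i) = i`. -/
def IsFlag (P : Set (Pt d)) (F : Fin d → Set (Pt d)) : Prop :=
  (∀ i, (F i).Nonempty ∧ IsExposed ℝ P (F i) ∧
    Module.finrank ℝ (vectorSpan ℝ (F i)) = (i : ℕ)) ∧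
  ∀ i j, i ≤ j → F i ⊆ F j

/-- The number of flags of `P`. -/
def flagCount (P : Set (Pt d)) : ℕ := {F : Fin d → Set (Pt d) | IsFlag P F}.ncard

/-- The closed half-space `{x | a ≤ u ⬝ x}` (for `u ≠ 0`). -/
def halfSpace (u : Pt d) (a : ℝ) : Set (Pt d) := {x | a ≤ ⟪u, x⟫}

/-- The support function `h_K(u)`. -/
def supportFn (K : Set (Pt d)) (u : Pt d) : ℝ := sSup ((fun x => ⟪u, x⟫) '' K)

/-- The cap of `K` with direction `u` and depth `t`. If `C = cap K u t`, then the cap `C ^ lam`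
is `cap K u (lam * t)`. -/
def cap (K : Set (Pt d)) (u : Pt d) (t : ℝ) : Set (Pt d) :=
  K ∩ halfSpace u (supportFn K u - t)

/-- The function `v(z)`: the least volume of `K ∩ H` over the closed half-spaces `H`
containing `z`. -/
def capVol (K : Set (Pt d)) (z : Pt d) : ℝ :=
  sInf {r : ℝ | ∃ (u : Pt d) (a : ℝ), u ≠ 0 ∧ z ∈ halfSpace u a ∧
    r = volume.real (K ∩ halfSpace u a)}

/-- The floating body `K(v ≥ t)`. -/
def floatingBody (K : Set (Pt d)) (t : ℝ) : Set (Pt d) := {z ∈ K | t ≤ capVol K z}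

/-- The wet part `K(v ≤ t)`. -/
def wetPart (K : Set (Pt d)) (t : ℝ) : Set (Pt d) := {z ∈ K | capVol K z ≤ t}

/-- `K(v = t)`, defined as the boundary of the floating body `K(v ≥ t)`. -/
def floatingBoundary (K : Set (Pt d)) (t : ℝ) : Set (Pt d) := frontier (floatingBody K t)

/-- The Macbeath region `M(z, lam) = z + lam [(K - z) ∩ (z - K)]`. -/
def macbeath (K : Set (Pt d)) (z : Pt d) (lam : ℝ) : Set (Pt d) :=
  (fun w => z + lam • w) '' {w | z + w ∈ K ∧ z - w ∈ K}

/-- The cap with unit direction `u` and depth `t` is a minimal cap of `z`. -/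
def IsMinimalCap (K : Set (Pt d)) (z u : Pt d) (t : ℝ) : Prop :=
  ‖u‖ = 1 ∧ z ∈ cap K u t ∧ volume.real (cap K u t) = capVol K z

/-- A choice of a saturated system `y 0, …, y (m - 1)` on `K(v = t)` together with a choice of
minimal caps `C(y j)`. Saturated means: the Macbeath regions `M(y j, 1/2)` are pairwise disjoint
and the system is maximal with this property, that is, the Macbeath region `M(z, 1/2)` of any
point `z` of `K(v = t)` meets one of them. -/
structure SaturatedSystem (K : Set (Pt d)) (t : ℝ) where
  /-- the number of points -/
  m : ℕ
  /-- the points -/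
  y : Fin m → Pt d
  /-- the direction of the minimal cap `C(y j)` -/
  dir : Fin m → Pt d
  /-- the depth of the minimal cap `C(y j)` -/
  depth : Fin m → ℝ
  mem_boundary : ∀ j, y j ∈ floatingBoundary K t
  disjoint : ∀ i j, i ≠ j → Disjoint (macbeath K (y i) (1 / 2)) (macbeath K (y j) (1 / 2))
  maximal : ∀ z ∈ floatingBoundary K t,
    ∃ j, (macbeath K z (1 / 2) ∩ macbeath K (y j) (1 / 2)).Nonempty
  minimalCap : ∀ j, IsMinimalCap K (y j) (dir j) (depth j)

/-- The half Macbeath region `K'_j = M(y j, 1/2) ∩ C(y j)`. -/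
def SaturatedSystem.half {K : Set (Pt d)} {t : ℝ} (Y : SaturatedSystem K t) (j : Fin Y.m) :
    Set (Pt d) :=
  macbeath K (Y.y j) (1 / 2) ∩ cap K (Y.dir j) (Y.depth j)

/-- The enlarged covering cap `K_j ^ lam`, where `K_j = C(y j) ^ 6`; so it is
`C(y j) ^ (6 lam)`. -/
def SaturatedSystem.bigCap {K : Set (Pt d)} {t : ℝ} (Y : SaturatedSystem K t) (lam : ℝ)
    (j : Fin Y.m) : Set (Pt d) :=
  cap K (Y.dir j) (6 * lam * Y.depth j)

end Geometry

/-! ### The parameters -/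

/-- `α = (6d)^d (4d² + d - 1)`. -/
def alpha (d : ℕ) : ℝ := (6 * d) ^ d * (4 * d ^ 2 + d - 1)

/-- `γ = 3 d³ 6^d`. -/
def gam (d : ℕ) : ℝ := 3 * d ^ 3 * 6 ^ d

/-- `T = α ln ln η / η`. -/
def paramT (d : ℕ) (η : ℝ) : ℝ := alpha d * Real.log (Real.log η) / η

/-- `T* = d 6^d T`. -/
def paramTstar (d : ℕ) (η : ℝ) : ℝ := d * 6 ^ d * paramT d η

/-- `s = 1 / (η (ln η)^β)` with `β = 4d² + d - 1`. -/
def paramS (d : ℕ) (η : ℝ) : ℝ := 1 / (η * Real.log η ^ (4 * (d : ℝ) ^ 2 + d - 1))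

/-- The sets `S_j`: closed sets with union `P` and pairwise disjoint interiors, with `K'_j ⊆ S_j`
and `S_j ∩ P(v ≤ T*) ⊆ K_j ^ γ`. -/
structure IsDissection {d : ℕ} (P : Set (Pt d)) (η : ℝ) (Y : SaturatedSystem P (paramT d η))
    (S : Fin Y.m → Set (Pt d)) : Prop where
  closed : ∀ j, IsClosed (S j)
  interior_disjoint : ∀ i j, i ≠ j → Disjoint (interior (S i)) (interior (S j))
  union_eq : ⋃ j, S j = P
  half_subset : ∀ j, Y.half j ⊆ S j
  wet_subset : ∀ j, S j ∩ wetPart P (paramTstar d η) ⊆ Y.bigCap (gam d) j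

/-! ### The Poisson process and the event `A` -/

/-- `X` is a (homogeneous) Poisson point process in `ℝ^d` of intensity `η`: the number of points
in a Borel set `B` of finite volume is Poisson distributed with parameter `η V(B)`, and the
numbers of points in pairwise disjoint Borel sets are independent. -/
structure IsPoissonProcess {d : ℕ} {Ω : Type*} [MeasurableSpace Ω] (μ : Measure Ω) (η : ℝ)
    (X : Ω → Set (Pt d)) : Prop where
  measurable_count : ∀ B : Set (Pt d), MeasurableSet B → Measurable fun ω => (X ω ∩ B).encard
  law_count : ∀ B : Set (Pt d), MeasurableSet B → volume B ≠ ∞ →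
    μ.map (fun ω => (X ω ∩ B).encard) =
      (poissonMeasure (Real.toNNReal (η * volume.real B))).map (fun n : ℕ => (n : ℕ∞))
  indep_count : ∀ (n : ℕ) (B : Fin n → Set (Pt d)), (∀ i, MeasurableSet (B i)) →
    (∀ i j, i ≠ j → Disjoint (B i) (B j)) →
    iIndepFun (fun (i : Fin n) (ω : Ω) => (X ω ∩ B i).encard) μ

/-- The event `A`: every `K'_j` contains a point of `X`, `P(v ≤ s)` contains no point of `X`, and
every `S'_j = S_j ∩ P(v ≤ T*)` contains at most `3 (6γ)^d α ln ln η` points of `X`. -/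
def eventA {d : ℕ} {Ω : Type*} (P : Set (Pt d)) (η : ℝ) (Y : SaturatedSystem P (paramT d η))
    (S : Fin Y.m → Set (Pt d)) (X : Ω → Set (Pt d)) : Set Ω :=
  {ω | (∀ j, (X ω ∩ Y.half j).Nonempty) ∧
    X ω ∩ wetPart P (paramS d η) = ∅ ∧
    ∀ j, (X ω ∩ (S j ∩ wetPart P (paramTstar d η))).Finite ∧
      ((X ω ∩ (S j ∩ wetPart P (paramTstar d η))).ncard : ℝ) ≤
        3 * (6 * gam d) ^ d * alpha d * Real.log (Real.log η)}

end PoissonPolytope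

end

/-!
Deterministically, everything rests on three facts about caps of a convex body `K`.

* A minimal cap satisfies `C(z) ⊆ M(z, 3 d)` (`IsMinimalCap.reflection_mem`). If the reflection of a
  point `x` of the cap, shrunk by `3 d`, were outside `K`, one could tilt the bounding hyperplane
  about `z` and lose volume: the wedge removed near `x` would be larger than the wedge added, as a
  homothety with centre `x` and a ratio whose `d`-th power exceeds `1 / 2` maps both into it. Hence
  `V(K'_j) ≥ (6 d)^(-d) T`.
* A half-space touching the floating body `K(v ≥ T)` cuts off at most `(d + 1) T`, by Helly's
  theorem (`volume_supporting_halfSpace_le`). Near the touching point saturation provides a region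
  `M(y_j, 1/2)`, which lies in the cap enlarged by the factor `9/2`; its volume is less than
  `T* = d 6^d T`. So every half-space meeting `K(v ≥ T*)` contains some `K'_j`, and a set that meets
  all `K'_j` has `K(v ≥ T*)` in its convex hull
  (`SaturatedSystem.floatingBody_subset_convexHull`).
* For a polytope of volume `1`, `V(P(v ≤ t)) ≤ c F(P) t log (1 / t) ^ (d - 1)` with `c` depending
  on `d` only (`volume_wetPart_le`). The barycentric subdivision covers `P` by one simplex for each
  flag (`exists_flag_mem_convexHull`), and in a simplex `v` is bounded below by a constant times the
  product of all barycentric coordinates but the largest. In the unit cube the set where the product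
  of the coordinates is at most `τ` has volume at most a multiple of `τ log (1 / τ) ^ (d - 1)`.

Since the `K'_j` are disjoint subsets of `P(v ≤ T)`, the first and the third fact bound their number
by a constant times `F(P) log η ^ (d - 1)` (`SaturatedSystem.card_le`).

The probability that `A` fails is estimated by the union bound. Each `K'_j` is missed with
probability at most `exp (-η (6 d)^(-d) T) = log η ^ (-β)`; the mean number of points in `P(v ≤ s)`
is of order `F(P) log η ^ (d - 1 - β)`; and the number of points in `S'_j ⊆ K_j^γ`, whose mean is at
most `(6 γ)^d α log log η`, exceeds three times this value with probability at most
`log η ^ (-β)`, by Chernoff's bound. As `β = 4 d² + d - 1`, this gives the upper estimate. The lower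
one holds because `P(v ≤ s)` contains a cap of volume `s`, which contains a point of the process
with probability at least `η s / 2`.
-/

noncomputable section

namespace PoissonPolytope

/-! ### Half-space sections, the function `v` and floating bodies -/

section HalfSpaces

variable {d : ℕ} {K : Set (Pt d)}

lemma isClosed_halfSpace (u : Pt d) (a : ℝ) : IsClosed (halfSpace u a) :=
  isClosed_le continuous_const (by fun_prop)

lemma convex_halfSpace (u : Pt d) (a : ℝ) : Convex ℝ (halfSpace u a) :=
  convex_halfSpace_ge (𝕜 := ℝ) (innerSL ℝ u).toLinearMap.isLinear a

lemma volume_hyperplane {u : Pt d} (hu : u ≠ 0) (a : ℝ) :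
    volume {x : Pt d | ⟪u, x⟫ = a} = 0 := by
  rcases Set.eq_empty_or_nonempty {x : Pt d | ⟪u, x⟫ = a} with h | ⟨x₀, hx₀⟩
  · simp [h]
  · have hx₀' : ⟪u, x₀⟫ = a := hx₀
    have hS : {x : Pt d | ⟪u, x⟫ = a} = (AffineSubspace.mk' x₀ (ℝ ∙ u)ᗮ : Set (Pt d)) := by
      ext x
      simp only [Set.mem_ofPred_eq, SetLike.mem_coe, AffineSubspace.mem_mk', vsub_eq_sub,
        Submodule.mem_orthogonal_singleton_iff_inner_right, inner_sub_right, hx₀', sub_eq_zero]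
    rw [hS]
    refine Measure.addHaar_affineSubspace _ _ fun htop => hu ?_
    have : u + x₀ ∈ AffineSubspace.mk' x₀ (ℝ ∙ u)ᗮ := by rw [htop]; trivial
    simpa [AffineSubspace.mem_mk', Submodule.mem_orthogonal_singleton_iff_inner_right] using this

lemma volume_inter_ne_top (hK : IsCompact K) (S : Set (Pt d)) : volume (K ∩ S) ≠ ∞ :=
  ((measure_mono inter_subset_left).trans_lt hK.measure_lt_top).ne

lemma measureReal_inter_mono (hK : IsCompact K) {S S' : Set (Pt d)} (h : K ∩ S ⊆ K ∩ S') :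
    volume.real (K ∩ S) ≤ volume.real (K ∩ S') :=
  measureReal_mono h (volume_inter_ne_top hK _)

/-- The volume cut off by a closed half-space depends continuously on the half-space, because
hyperplanes are null sets. -/
lemma continuousAt_volume_halfSpace (hK : IsCompact K) {p : Pt d × ℝ} (hp : p.1 ≠ 0) :
    ContinuousAt (fun q : Pt d × ℝ => volume.real (K ∩ halfSpace q.1 q.2)) p := by
  have key : ∀ q : Pt d × ℝ, volume.real (K ∩ halfSpace q.1 q.2) =
      ∫ x in K, (halfSpace q.1 q.2).indicator (fun _ => (1 : ℝ)) x := by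
    intro q
    rw [integral_indicator (isClosed_halfSpace _ _).measurableSet, setIntegral_const, smul_eq_mul,
      mul_one, measureReal_restrict_apply (isClosed_halfSpace _ _).measurableSet, inter_comm]
  simp only [key]
  refine continuousAt_of_dominated (bound := fun _ => 1) ?_ ?_ ?_ ?_
  · exact .of_forall fun q => (aestronglyMeasurable_const.indicator
      (isClosed_halfSpace _ _).measurableSet)
  · refine .of_forall fun q => .of_forall fun x => ?_
    rw [norm_indicator_eq_indicator_norm]
    exact (indicator_le_self' (by simp) x).trans (by simp)
  · have := hK.measure_lt_top (μ := volume)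
    exact integrableOn_const this.ne
  · have h0 : ∀ᵐ x ∂(volume.restrict K : Measure (Pt d)), ⟪p.1, x⟫ ≠ p.2 :=
      ae_restrict_of_ae (by
        rw [ae_iff]; simpa using volume_hyperplane hp p.2)
    filter_upwards [h0] with x hx
    have hcont : Continuous fun q : Pt d × ℝ => ⟪q.1, x⟫ - q.2 := by fun_prop
    rcases lt_or_gt_of_ne hx with hlt | hgt
    · refine (continuousAt_const (y := (0 : ℝ))).congr ?_
      filter_upwards [hcont.continuousAt.eventually_lt continuousAt_const
        (show ⟪p.1, x⟫ - p.2 < 0 by linarith)] with q hq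
      rw [indicator_of_notMem]
      simp only [halfSpace, mem_ofPred_eq, not_le]; linarith
    · refine (continuousAt_const (y := (1 : ℝ))).congr ?_
      filter_upwards [hcont.continuousAt.eventually_const_lt
        (show 0 < ⟪p.1, x⟫ - p.2 by linarith)] with q hq
      rw [indicator_of_mem]
      simp only [halfSpace, mem_ofPred_eq]; linarith

lemma continuous_volume_halfSpace (hK : IsCompact K) {u : Pt d} (hu : u ≠ 0) :
    Continuous fun a : ℝ => volume.real (K ∩ halfSpace u a) :=
  continuous_iff_continuousAt.2 fun a =>
    ContinuousAt.comp (f := fun a : ℝ => (u, a))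
      (continuousAt_volume_halfSpace hK (p := (u, a)) hu) (by fun_prop)

lemma capVol_le {z u : Pt d} {a : ℝ} (hu : u ≠ 0) (hz : z ∈ halfSpace u a) :
    capVol K z ≤ volume.real (K ∩ halfSpace u a) :=
  csInf_le ⟨0, by rintro r ⟨u, a, -, -, rfl⟩; exact measureReal_nonneg⟩ ⟨u, a, hu, hz, rfl⟩

lemma exists_unit (hd : 0 < d) : ∃ u : Pt d, ‖u‖ = 1 :=
  ⟨EuclideanSpace.single ⟨0, hd⟩ 1, by simp⟩

lemma le_capVol (hd : 0 < d) {z : Pt d} {t : ℝ}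
    (h : ∀ (u : Pt d) (a : ℝ), u ≠ 0 → z ∈ halfSpace u a → t ≤ volume.real (K ∩ halfSpace u a)) :
    t ≤ capVol K z := by
  obtain ⟨u, hu⟩ := exists_unit hd
  refine le_csInf ⟨_, u, ⟪u, z⟫, ?_, le_refl (α := ℝ) _, rfl⟩ ?_
  · rintro rfl; simp at hu
  · rintro r ⟨u, a, hu, hz, rfl⟩; exact h u a hu hz

lemma capVol_nonneg (z : Pt d) : 0 ≤ capVol K z :=
  Real.sInf_nonneg (by rintro r ⟨u, a, -, -, rfl⟩; exact measureReal_nonneg)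

/-- In the infimum defining `v(z)` it suffices to take half-spaces with unit normal whose boundary
contains `z`. -/
lemma capVol_eq_sInf_sphere (hd : 0 < d) (hK : IsCompact K) (z : Pt d) :
    capVol K z = sInf ((fun u : Metric.sphere (0 : Pt d) 1 =>
      volume.real (K ∩ halfSpace (u : Pt d) ⟪(u : Pt d), z⟫)) '' univ) := by
  apply le_antisymm
  · obtain ⟨u, hu⟩ := exists_unit hd
    refine le_csInf ⟨_, ⟨u, by simp [hu]⟩, trivial, rfl⟩ ?_
    rintro _ ⟨u, -, rfl⟩
    exact capVol_le (ne_zero_of_mem_unit_sphere u) (le_refl (α := ℝ) _)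
  · refine le_capVol hd fun u a hu hz => ?_
    have hn : 0 < ‖u‖ := norm_pos_iff.2 hu
    have hmem : ‖u‖⁻¹ • u ∈ Metric.sphere (0 : Pt d) 1 := by
      simp [norm_smul, hn.ne']
    refine (csInf_le ⟨0, ?_⟩ (mem_image_of_mem _ (mem_univ ⟨_, hmem⟩))).trans ?_
    · rintro _ ⟨u, -, rfl⟩; exact measureReal_nonneg
    · refine measureReal_inter_mono hK (inter_subset_inter_right _ fun x hx => ?_)
      simp only [halfSpace, mem_ofPred_eq, inner_smul_left, RCLike.conj_to_real] at hx hz ⊢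
      exact hz.trans (le_of_mul_le_mul_left hx (inv_pos.2 hn))

lemma continuous_capVol (hd : 0 < d) (hK : IsCompact K) : Continuous (capVol K) := by
  let f : Pt d → Metric.sphere (0 : Pt d) 1 → ℝ := fun z u =>
    volume.real (K ∩ halfSpace (u : Pt d) ⟪(u : Pt d), z⟫)
  have hf : Continuous ↿f := by
    refine continuous_iff_continuousAt.2 fun p => ?_
    exact ContinuousAt.comp (f := fun p : Pt d × Metric.sphere (0 : Pt d) 1 =>
      ((p.2 : Pt d), ⟪(p.2 : Pt d), p.1⟫))
      (continuousAt_volume_halfSpace hK (ne_zero_of_mem_unit_sphere p.2)) (by fun_prop)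
  have h := IsCompact.continuous_sInf isCompact_univ hf
  exact h.congr fun z => (capVol_eq_sInf_sphere hd hK z).symm

/-- Separation of a point from a closed convex set, in terms of inner products. -/
lemma exists_inner_lt_of_notMem (hc : Convex ℝ K) (hcl : IsClosed K) {z : Pt d} (hz : z ∉ K) :
    ∃ (w : Pt d) (s : ℝ), (∀ x ∈ K, ⟪w, x⟫ < s) ∧ s < ⟪w, z⟫ := by
  obtain ⟨f, s, hf, hs⟩ := geometric_hahn_banach_closed_point hc hcl hz
  refine ⟨(InnerProductSpace.toDual ℝ (Pt d)).symm f, s, fun x hx => ?_, ?_⟩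
  · simpa using hf x hx
  · simpa using hs

lemma capVol_eq_zero_of_notMem (hK : IsCompact K) (hc : Convex ℝ K) {z : Pt d} (hz : z ∉ K) :
    capVol K z = 0 := by
  rcases K.eq_empty_or_nonempty with rfl | ⟨x₀, hx₀⟩
  · refine le_antisymm (Real.sInf_nonpos ?_) (capVol_nonneg z)
    rintro r ⟨u, a, -, -, rfl⟩; simp
  obtain ⟨w, s, h1, h2⟩ := exists_inner_lt_of_notMem hc hK.isClosed hz
  refine le_antisymm ?_ (capVol_nonneg z)
  have hw : w ≠ 0 := by
    rintro rfl
    have := h1 x₀ hx₀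
    simp only [inner_zero_left] at this h2
    linarith
  refine (capVol_le hw (show z ∈ halfSpace w s from h2.le)).trans ?_
  have : K ∩ halfSpace w s = ∅ := by
    ext x
    simp only [mem_inter_iff, halfSpace, mem_ofPred_eq, mem_empty_iff_false, iff_false, not_and,
      not_le]
    exact fun hx => h1 x hx
  simp [this]

lemma mem_of_capVol_pos (hK : IsCompact K) (hc : Convex ℝ K) {z : Pt d} (hz : 0 < capVol K z) :
    z ∈ K := by
  by_contra h
  exact hz.ne' (capVol_eq_zero_of_notMem hK hc h)

lemma isClosed_floatingBody (hd : 0 < d) (hK : IsCompact K) (t : ℝ) :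
    IsClosed (floatingBody K t) :=
  hK.isClosed.inter (isClosed_le continuous_const (continuous_capVol hd hK))

lemma isClosed_wetPart (hd : 0 < d) (hK : IsCompact K) (t : ℝ) : IsClosed (wetPart K t) :=
  hK.isClosed.inter (isClosed_le (continuous_capVol hd hK) continuous_const)

lemma isCompact_floatingBody (hd : 0 < d) (hK : IsCompact K) (t : ℝ) :
    IsCompact (floatingBody K t) :=
  hK.of_isClosed_subset (isClosed_floatingBody hd hK t) fun _ h => h.1

/-- A floating body is convex: a half-space containing a point of a segment contains one of its
end points. -/
lemma convex_floatingBody (hd : 0 < d) (hc : Convex ℝ K) (t : ℝ) :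
    Convex ℝ (floatingBody K t) := by
  intro x hx y hy a b ha hb hab
  refine ⟨hc hx.1 hy.1 ha hb hab, le_capVol hd fun u r hu hz => ?_⟩
  have hz' : r ≤ a * ⟪u, x⟫ + b * ⟪u, y⟫ := by
    simpa [halfSpace, inner_add_right, inner_smul_right] using hz
  by_cases h : r ≤ ⟪u, x⟫
  · exact hx.2.trans (capVol_le hu h)
  · refine hy.2.trans (capVol_le hu ?_)
    by_contra h'
    simp only [halfSpace, mem_ofPred_eq, not_le] at h h'
    have hb' : a * ⟪u, x⟫ + b * ⟪u, y⟫ < r := by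
      rcases ha.eq_or_lt with rfl | ha'
      · have : b = 1 := by linarith
        subst this; linarith
      · calc a * ⟪u, x⟫ + b * ⟪u, y⟫ < a * r + b * r :=
              add_lt_add_of_lt_of_le (mul_lt_mul_of_pos_left h ha')
                (mul_le_mul_of_nonneg_left h'.le hb)
          _ = r := by rw [← add_mul, hab, one_mul]
    linarith

lemma capVol_eq_of_mem_floatingBoundary (hd : 0 < d) (hK : IsCompact K) (hc : Convex ℝ K)
    {t : ℝ} (ht : 0 < t) {z : Pt d} (hz : z ∈ floatingBoundary K t) :
    z ∈ K ∧ capVol K z = t := by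
  have hmem : z ∈ floatingBody K t := (isClosed_floatingBody hd hK t).frontier_subset hz
  refine ⟨hmem.1, le_antisymm ?_ hmem.2⟩
  by_contra! hlt
  have hopen : IsOpen {x | t < capVol K x} :=
    isOpen_lt continuous_const (continuous_capVol hd hK)
  have hsub : {x | t < capVol K x} ⊆ floatingBody K t := fun x hx =>
    ⟨mem_of_capVol_pos hK hc (ht.trans hx), le_of_lt hx⟩
  exact hz.2 (interior_maximal hsub hopen hlt)

end HalfSpaces

/-! ### Caps and Macbeath regions -/

section Caps

variable {d : ℕ} {K : Set (Pt d)}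

lemma volume_homothety (x : Pt d) {s : ℝ} (hs : 0 ≤ s) (S : Set (Pt d)) :
    volume.real (AffineMap.homothety x s '' S) = s ^ d * volume.real S := by
  rw [measureReal_def, Measure.addHaar_image_homothety, ENNReal.toReal_mul,
    finrank_euclideanSpace_fin, abs_of_nonneg (pow_nonneg hs d),
    ENNReal.toReal_ofReal (pow_nonneg hs d), measureReal_def]

lemma homothety_eq (x y : Pt d) (s : ℝ) : AffineMap.homothety x s y = x + s • (y - x) := by
  simp [AffineMap.homothety_apply, add_comm]

lemma homothety_mem (hc : Convex ℝ K) {x y : Pt d} (hx : x ∈ K) (hy : y ∈ K) {s : ℝ}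
    (h0 : 0 ≤ s) (h1 : s ≤ 1) : x + s • (y - x) ∈ K :=
  hc.add_smul_sub_mem hx hy ⟨h0, h1⟩

/-- A convex body meeting an open set does so in a set of positive volume. -/
lemma volume_inter_pos (hc : Convex ℝ K) (hi : (interior K).Nonempty) {U : Set (Pt d)}
    (hU : IsOpen U) (h : (K ∩ U).Nonempty) : 0 < volume (K ∩ U) := by
  obtain ⟨x, hxK, hxU⟩ := h
  have hcl : x ∈ closure (interior K) := by
    rw [hc.closure_interior_eq_closure_of_nonempty_interior hi]; exact subset_closure hxK
  obtain ⟨y, hyU, hyK⟩ := mem_closure_iff.1 hcl U hU hxU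
  exact ((hU.inter isOpen_interior).measure_pos volume ⟨y, hyU, hyK⟩).trans_le
    (measure_mono fun z hz => ⟨interior_subset hz.2, hz.1⟩)

lemma volumeReal_inter_pos (hK : IsCompact K) (hc : Convex ℝ K) (hi : (interior K).Nonempty)
    {U : Set (Pt d)} (hU : IsOpen U) (h : (K ∩ U).Nonempty) : 0 < volume.real (K ∩ U) :=
  ENNReal.toReal_pos (volume_inter_pos hc hi hU h).ne' (volume_inter_ne_top hK U)

/-- The points of a minimal cap of `z` lie beyond the parallel hyperplane through `z`: otherwise
the cap could be cut down to a smaller one still containing `z`. -/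
lemma IsMinimalCap.inner_le (hK : IsCompact K) (hc : Convex ℝ K) (hi : (interior K).Nonempty)
    {z u : Pt d} {t : ℝ} (h : IsMinimalCap K z u t) {x : Pt d} (hx : x ∈ cap K u t) :
    ⟪u, z⟫ ≤ ⟪u, x⟫ := by
  by_contra! hlt
  obtain ⟨hu, hz, hv⟩ := h
  have hu0 : u ≠ 0 := by rintro rfl; simp at hu
  set a := supportFn K u - t with ha
  have hxa : a ≤ ⟪u, x⟫ := hx.2
  have hza : a ≤ ⟪u, z⟫ := hz.2
  set U : Set (Pt d) := {y | a < ⟪u, y⟫ ∧ ⟪u, y⟫ < ⟪u, z⟫} with hUdef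
  have hU : IsOpen U := by
    apply IsOpen.and <;> exact isOpen_lt (by fun_prop) (by fun_prop)
  have hne : (K ∩ U).Nonempty := by
    refine ⟨x + (1 / 2 : ℝ) • (z - x), homothety_mem hc hx.1 hz.1 (by norm_num) (by norm_num), ?_⟩
    simp only [hUdef, mem_ofPred_eq, inner_add_right, inner_smul_right, inner_sub_right]
    constructor <;> linarith
  have hpos := volumeReal_inter_pos hK hc hi hU hne
  have hle : capVol K z ≤ volume.real (K ∩ halfSpace u ⟪u, z⟫) := capVol_le hu0 (le_refl (α := ℝ) _)
  have hdisj : Disjoint (K ∩ U) (K ∩ halfSpace u ⟪u, z⟫) := by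
    rw [Set.disjoint_left]
    rintro y ⟨-, -, h1⟩ ⟨-, h2⟩
    exact absurd h2 (not_le.2 h1)
  have hsub : (K ∩ U) ∪ (K ∩ halfSpace u ⟪u, z⟫) ⊆ cap K u t := by
    rintro y (⟨hy, h1, h2⟩ | ⟨hy, h1⟩)
    · exact ⟨hy, h1.le⟩
    · exact ⟨hy, hza.trans h1⟩
  have h3 := measureReal_mono (μ := volume) hsub (volume_inter_ne_top hK _)
  rw [measureReal_union hdisj (hK.isClosed.measurableSet.inter
    (isClosed_halfSpace _ _).measurableSet) (volume_inter_ne_top hK _)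
    (volume_inter_ne_top hK _), hv] at h3
  linarith

lemma one_lt_two_mul_pow (hd : 0 < d) : 1 < 2 * (1 / (1 + 2 / (3 * d)) : ℝ) ^ d := by
  have hd' : (0 : ℝ) < d := by exact_mod_cast hd
  have h1 : (1 + 2 / (3 * d) : ℝ) ^ d < 2 := by
    calc (1 + 2 / (3 * d) : ℝ) ^ d ≤ (Real.exp (2 / (3 * d))) ^ d := by
          gcongr; linarith [Real.add_one_le_exp (2 / (3 * d) : ℝ)]
      _ = Real.exp (2 / 3) := by rw [← Real.exp_nat_mul]; congr 1; field_simp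
      _ < Real.exp (Real.log 2) := Real.exp_lt_exp.2 (by linarith [Real.log_two_gt_d9])
      _ = 2 := Real.exp_log two_pos
  rw [div_pow, one_pow, mul_one_div, one_lt_div (by positivity)]
  exact h1

/-- Let the half-space `{u ⬝ y ≥ u ⬝ z}` cut off the least volume among all half-spaces through
`z`, and let `x ∈ K` be in its interior. Then `z - (x - z) / (3 d) ∈ K`.

If not, an affine function `f` with `f z = 0` satisfies `f > -b` on `K` and `f x > 3 d b`. Tilting
the half-space by `f` so that `x` comes to lie in the middle of the removed wedge, the removed
wedge `A` has more volume than the added wedge `B`: the homothety with centre `x` and ratio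
`3 d / (3 d + 2)`, whose `d`-th power exceeds `1 / 2`, maps both wedges into `A`. -/
lemma reflection_mem_of_lt (hd : 0 < d) (hK : IsCompact K) (hc : Convex ℝ K)
    (hi : (interior K).Nonempty) {z u : Pt d} (hz : z ∈ K)
    (hmin : ∀ n : Pt d, n ≠ 0 →
      volume.real (K ∩ halfSpace u ⟪u, z⟫) ≤ volume.real (K ∩ halfSpace n ⟪n, z⟫))
    {x : Pt d} (hx : x ∈ K) (hxu : ⟪u, z⟫ < ⟪u, x⟫) :
    z - (1 / (3 * d) : ℝ) • (x - z) ∈ K := by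
  by_contra hnot
  have hd' : (0 : ℝ) < d := by exact_mod_cast hd
  obtain ⟨w, σ, hw1, hw2⟩ := exists_inner_lt_of_notMem hc hK.isClosed hnot
  -- `U` and `f` are the two affine functions vanishing at `z`.
  set U : Pt d → ℝ := fun y => ⟪u, y⟫ - ⟪u, z⟫ with hU
  set f : Pt d → ℝ := fun y => ⟪w, z⟫ - ⟪w, y⟫ with hf
  set b : ℝ := σ - ⟪w, z⟫ with hb
  have hb0 : 0 < b := by have := hw1 z hz; simp only [hb]; linarith
  have hUx : 0 < U x := by simp only [hU]; linarith
  have hfx : 3 * d * b < f x := by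
    rw [inner_sub_right, inner_smul_right, inner_sub_right] at hw2
    have : b < 1 / (3 * d) * f x := by simp only [hb, hf]; linarith
    rw [one_div, inv_mul_eq_div, lt_div_iff₀ (by positivity)] at this
    linarith
  have hfK : ∀ y ∈ K, -b < f y := fun y hy => by
    have := hw1 y hy; simp only [hb, hf]; linarith
  have hfx0 : 0 < f x := lt_trans (by positivity) hfx
  set ε : ℝ := 2 * U x / f x with hε
  have hε0 : 0 < ε := by positivity
  have hεf : ε * f x = 2 * U x := by rw [hε]; field_simp
  set ρ : ℝ := 1 / (1 + 2 / (3 * d)) with hρ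
  have hρ0 : 0 < ρ := by positivity
  have hρ1 : ρ ≤ 1 := by
    rw [hρ, div_le_one (by positivity)]; linarith [show (0 : ℝ) < 2 / (3 * d) by positivity]
  have hρe : ρ * (2 / (3 * d)) = 1 - ρ := by rw [hρ]; field_simp; ring
  have hεb : ε * b < U x * (2 / (3 * d)) := by
    have : ε * (3 * d * b) < ε * f x := mul_lt_mul_of_pos_left hfx hε0
    rw [hεf] at this
    rw [mul_div_assoc', lt_div_iff₀ (by positivity)]
    linarith
  have hUφ : ∀ y, U (x + ρ • (y - x)) = (1 - ρ) * U x + ρ * U y := fun y => by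
    simp only [hU, inner_add_right, inner_smul_right, inner_sub_right]; ring
  have hfφ : ∀ y, f (x + ρ • (y - x)) = (1 - ρ) * f x + ρ * f y := fun y => by
    simp only [hf, inner_add_right, inner_smul_right, inner_sub_right]; ring
  have hcU : Continuous U := by fun_prop
  have hcf : Continuous f := by fun_prop
  -- the removed wedge `A`, the added wedge `B`, and the part `D` of `K` sent into `A`
  set A : Set (Pt d) := K ∩ {y | 0 ≤ U y ∧ U y < ε * f y} with hA
  set B : Set (Pt d) := K ∩ {y | ε * f y ≤ U y ∧ U y < 0} with hB
  set C : Set (Pt d) := K ∩ {y | 0 ≤ U y ∧ ε * f y ≤ U y} with hC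
  set D : Set (Pt d) := K ∩ {y | x + ρ • (y - x) ∈ A} with hD
  have mA : MeasurableSet A := hK.isClosed.measurableSet.inter
    ((isClosed_le continuous_const hcU).measurableSet.inter
      (isOpen_lt hcU (by fun_prop)).measurableSet)
  have mB : MeasurableSet B := hK.isClosed.measurableSet.inter
    ((isClosed_le (by fun_prop) hcU).measurableSet.inter
      (isOpen_lt hcU continuous_const).measurableSet)
  have hAB : volume.real A ≤ volume.real B := by
    have h1 : K ∩ halfSpace u ⟪u, z⟫ = C ∪ A := by
      ext y
      simp only [hA, hC, hU, halfSpace, mem_inter_iff, mem_union, mem_ofPred_eq, sub_nonneg]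
      rcases le_or_gt (ε * f y) (⟪u, y⟫ - ⟪u, z⟫) with h | h
      · simp [h, not_lt.2 h]
      · simp [h, not_le.2 h]
    have h2 : K ∩ halfSpace (u + ε • w) ⟪u + ε • w, z⟫ = C ∪ B := by
      ext y
      have hiff : ⟪u + ε • w, z⟫ ≤ ⟪u + ε • w, y⟫ ↔ ε * f y ≤ U y := by
        simp only [inner_add_left, inner_smul_left, RCLike.conj_to_real, hU, hf]
        constructor <;> intro h <;> linarith
      simp only [hB, hC, halfSpace, mem_inter_iff, mem_union, mem_ofPred_eq, hiff]
      rcases le_or_gt 0 (U y) with h | h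
      · simp [h, not_lt.2 h]
      · simp [h, not_le.2 h]
    have hn : u + ε • w ≠ 0 := by
      intro h0
      have : ⟪u + ε • w, x - z⟫ = 0 := by rw [h0, inner_zero_left]
      simp only [inner_add_left, inner_smul_left, RCLike.conj_to_real, inner_sub_right] at this
      have h3 : U x = ε * f x := by simp only [hU, hf]; linarith
      linarith
    have h3 := hmin _ hn
    rw [h1, h2, measureReal_union _ mA (volume_inter_ne_top hK _) (volume_inter_ne_top hK _),
      measureReal_union _ mB (volume_inter_ne_top hK _) (volume_inter_ne_top hK _)] at h3
    · linarith
    · rw [Set.disjoint_left]; rintro y ⟨-, h4, -⟩ ⟨-, -, h5⟩; exact absurd h4 (not_le.2 h5)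
    · rw [Set.disjoint_left]; rintro y ⟨-, -, h4⟩ ⟨-, -, h5⟩; exact absurd h4 (not_le.2 h5)
  have hBD : B ⊆ D := by
    rintro y ⟨hyK, h1, h2⟩
    refine ⟨hyK, homothety_mem hc hx hyK hρ0.le hρ1, ?_⟩
    have h3 : ε * -b < ε * f y := mul_lt_mul_of_pos_left (hfK y hyK) hε0
    have h4 : ρ * (ε * b) < (1 - ρ) * U x := by
      rw [← hρe]
      calc ρ * (ε * b) < ρ * (U x * (2 / (3 * d))) := mul_lt_mul_of_pos_left hεb hρ0
        _ = _ := by ring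
    simp only [mem_ofPred_eq, hUφ, hfφ]
    constructor
    · have := mul_le_mul_of_nonneg_left h1 hρ0.le
      have := mul_lt_mul_of_pos_left h3 hρ0
      linarith
    · have h5 := mul_lt_mul_of_pos_left h2 hρ0
      have h6 := mul_lt_mul_of_pos_left h3 hρ0
      have h7 : ε * ((1 - ρ) * f x + ρ * f y) = (1 - ρ) * (2 * U x) + ρ * (ε * f y) := by
        rw [← hεf]; ring
      rw [h7]; linarith
  have hAD : A ⊆ D := by
    rintro y ⟨hyK, h1, h2⟩
    refine ⟨hyK, homothety_mem hc hx hyK hρ0.le hρ1, ?_⟩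
    simp only [mem_ofPred_eq, hUφ, hfφ]
    have h0 : (0 : ℝ) ≤ 1 - ρ := by linarith
    constructor
    · positivity
    · have h5 := mul_lt_mul_of_pos_left h2 hρ0
      have h7 : ε * ((1 - ρ) * f x + ρ * f y) = (1 - ρ) * (2 * U x) + ρ * (ε * f y) := by
        rw [← hεf]; ring
      rw [h7]; nlinarith
  have hφD : ρ ^ d * volume.real D ≤ volume.real A := by
    rw [← volume_homothety x hρ0.le]
    refine measureReal_mono ?_ (volume_inter_ne_top hK _)
    rintro _ ⟨y, hy, rfl⟩
    rw [homothety_eq]; exact hy.2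
  have hABD : volume.real A + volume.real B ≤ volume.real D := by
    rw [← measureReal_union _ mB (volume_inter_ne_top hK _) (volume_inter_ne_top hK _)]
    · exact measureReal_mono (union_subset hAD hBD) (volume_inter_ne_top hK _)
    · rw [Set.disjoint_left]; rintro y ⟨-, h4, -⟩ ⟨-, -, h5⟩; exact absurd h4 (not_le.2 h5)
  have hDpos : 0 < volume.real D := by
    set O : Set (Pt d) := {y | 0 < U (x + ρ • (y - x)) ∧
      U (x + ρ • (y - x)) < ε * f (x + ρ • (y - x))} with hO
    have hOo : IsOpen O := by
      apply IsOpen.and <;> exact isOpen_lt (by fun_prop) (by fun_prop)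
    have hxO : x ∈ O := by
      simp only [hO, mem_ofPred_eq, sub_self, smul_zero, add_zero]
      exact ⟨hUx, by rw [hεf]; linarith⟩
    refine (volumeReal_inter_pos hK hc hi hOo ⟨x, hx, hxO⟩).trans_le
      (measureReal_mono ?_ (volume_inter_ne_top hK _))
    rintro y ⟨hyK, h1, h2⟩
    exact ⟨hyK, homothety_mem hc hx hyK hρ0.le hρ1, h1.le, h2⟩
  have := one_lt_two_mul_pow hd
  nlinarith

/-- A minimal cap `C(z)` is contained in the Macbeath region `M(z, 3 d)`. -/
lemma IsMinimalCap.reflection_mem (hd : 0 < d) (hK : IsCompact K) (hc : Convex ℝ K)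
    (hi : (interior K).Nonempty) {z u : Pt d} {t : ℝ} (h : IsMinimalCap K z u t)
    (hv : 0 < capVol K z) {x : Pt d} (hx : x ∈ cap K u t) :
    z - (1 / (3 * d) : ℝ) • (x - z) ∈ K := by
  have hzK : z ∈ K := h.2.1.1
  have hu0 : u ≠ 0 := by rintro rfl; simpa using h.1
  have hmin : ∀ n : Pt d, n ≠ 0 →
      volume.real (K ∩ halfSpace u ⟪u, z⟫) ≤ volume.real (K ∩ halfSpace n ⟪n, z⟫) := by
    intro n hn
    refine le_trans ?_ (capVol_le hn (le_refl (α := ℝ) _))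
    rw [← h.2.2]
    exact measureReal_inter_mono hK
      (inter_subset_inter_right _ fun y hy => le_trans (α := ℝ) h.2.1.2 hy)
  obtain ⟨p, hpK, hp⟩ : ∃ p ∈ K, ⟪u, z⟫ < ⟪u, p⟫ := by
    by_contra! hno
    refine hv.ne' (le_antisymm ?_ (capVol_nonneg z))
    refine (capVol_le hu0 (le_refl (α := ℝ) ⟪u, z⟫)).trans ?_
    have h0 : volume.real {x : Pt d | ⟪u, x⟫ = ⟪u, z⟫} = 0 := by
      rw [measureReal_def, volume_hyperplane hu0, ENNReal.toReal_zero]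
    rw [← h0]
    refine measureReal_mono (fun y hy => le_antisymm (hno y hy.1) hy.2) ?_
    rw [volume_hyperplane hu0]; simp
  -- approximate `x` by points strictly beyond the hyperplane
  have hlim : Filter.Tendsto (fun κ : ℝ => z - (1 / (3 * d) : ℝ) • ((x + κ • (p - x)) - z))
      (nhdsWithin 0 (Ioi 0)) (nhds (z - (1 / (3 * d) : ℝ) • (x - z))) := by
    have : Continuous fun κ : ℝ => z - (1 / (3 * d) : ℝ) • ((x + κ • (p - x)) - z) := by fun_prop
    simpa using (this.tendsto 0).mono_left nhdsWithin_le_nhds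
  refine hK.isClosed.mem_of_tendsto hlim ?_
  filter_upwards [Ioo_mem_nhdsGT (show (0 : ℝ) < 1 by norm_num)] with κ hκ
  refine reflection_mem_of_lt hd hK hc hi hzK hmin (homothety_mem hc hx.1 hpK hκ.1.le hκ.2.le) ?_
  have := h.inner_le hK hc hi hx
  simp only [inner_add_right, inner_smul_right, inner_sub_right]
  nlinarith [hκ.1, hκ.2]

/-- A half Macbeath region contains a copy, scaled by `1 / (6 d)`, of the minimal cap. -/
lemma le_volume_half_macbeath (hd : 0 < d) (hK : IsCompact K) (hc : Convex ℝ K)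
    (hi : (interior K).Nonempty) {z u : Pt d} {t : ℝ} (h : IsMinimalCap K z u t)
    (hv : 0 < capVol K z) :
    ((6 * d : ℝ) ^ d)⁻¹ * capVol K z ≤ volume.real (macbeath K z (1 / 2) ∩ cap K u t) := by
  have hd' : (1 : ℝ) ≤ d := by exact_mod_cast hd
  have hcapc : Convex ℝ (cap K u t) := hc.inter (convex_halfSpace _ _)
  rw [← inv_pow, ← h.2.2, ← volume_homothety z (by positivity)]
  refine measureReal_mono ?_
    ((measure_mono (inter_subset_right.trans inter_subset_left)).trans_lt hK.measure_lt_top).ne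
  have h0 : (0 : ℝ) ≤ (6 * d : ℝ)⁻¹ := by positivity
  have h1 : (6 * d : ℝ)⁻¹ ≤ 1 := inv_le_one_of_one_le₀ (by linarith)
  rintro _ ⟨x, hx, rfl⟩
  rw [homothety_eq]
  refine ⟨⟨(1 / (3 * d) : ℝ) • (x - z), ⟨?_, h.reflection_mem hd hK hc hi hv hx⟩, ?_⟩,
    homothety_mem hcapc h.2.1 hx h0 h1⟩
  · refine homothety_mem hc h.2.1.1 hx.1 (by positivity) ?_
    rw [div_le_one (by positivity)]; linarith
  · simp only [smul_smul]
    congr 2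
    field_simp; norm_num

lemma inner_le_supportFn (hK : IsCompact K) (u : Pt d) {x : Pt d} (hx : x ∈ K) :
    ⟪u, x⟫ ≤ supportFn K u :=
  le_csSup (hK.image (by fun_prop : Continuous fun x => ⟪u, x⟫)).bddAbove ⟨x, hx, rfl⟩

lemma exists_inner_eq_supportFn (hK : IsCompact K) (hne : K.Nonempty) (u : Pt d) :
    ∃ x ∈ K, ⟪u, x⟫ = supportFn K u :=
  (hK.image (by fun_prop : Continuous fun x => ⟪u, x⟫)).sSup_mem (hne.image _)

/-- Enlarging the depth of a cap by a factor `lam ≥ 1` enlarges its volume by at most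
`lam ^ d`: shrink the larger cap towards its apex. -/
lemma volume_cap_mul_le (hK : IsCompact K) (hc : Convex ℝ K) (hne : K.Nonempty) (u : Pt d)
    (t : ℝ) {lam : ℝ} (hl : 1 ≤ lam) :
    volume.real (cap K u (lam * t)) ≤ lam ^ d * volume.real (cap K u t) := by
  obtain ⟨x₀, hx₀, he⟩ := exists_inner_eq_supportFn hK hne u
  have hl0 : 0 < lam := by linarith
  have key : lam⁻¹ ^ d * volume.real (cap K u (lam * t)) ≤ volume.real (cap K u t) := by
    rw [← volume_homothety x₀ (by positivity)]
    refine measureReal_mono ?_ (volume_inter_ne_top hK _)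
    rintro _ ⟨y, hy, rfl⟩
    rw [homothety_eq]
    refine ⟨homothety_mem hc hx₀ hy.1 (by positivity) (inv_le_one_of_one_le₀ hl), ?_⟩
    have h1 : supportFn K u - lam * t ≤ ⟪u, y⟫ := hy.2
    simp only [halfSpace, mem_ofPred_eq, inner_add_right, inner_smul_right, inner_sub_right, he]
    have h2 : lam⁻¹ * (supportFn K u - ⟪u, y⟫) ≤ lam⁻¹ * (lam * t) :=
      mul_le_mul_of_nonneg_left (by linarith) (by positivity)
    rw [inv_mul_cancel_left₀ hl0.ne'] at h2
    linarith
  rw [inv_pow, inv_mul_le_iff₀ (by positivity)] at key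
  exact key

/-- If `M(y, 1/2)` and `M(z, 1/2)` meet, then `M(y, 1/2) ⊆ M(z, 7/2)`. -/
lemma reflection_mem_of_macbeath_inter (hc : Convex ℝ K) {y z w : Pt d}
    (h : (macbeath K z (1 / 2) ∩ macbeath K y (1 / 2)).Nonempty)
    (hw : w ∈ macbeath K y (1 / 2)) : z - (2 / 7 : ℝ) • (w - z) ∈ K := by
  obtain ⟨_, ⟨q, ⟨hq1, hq2⟩, rfl⟩, ⟨r, ⟨hr1, hr2⟩, hr⟩⟩ := h
  obtain ⟨p, ⟨hp1, hp2⟩, rfl⟩ := hw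
  simp only at hr
  have hy : y = z + (1 / 2 : ℝ) • q - (1 / 2 : ℝ) • r := by rw [← hr]; abel
  have h1 := hc hq2 hr1 (a := (1 / 2 : ℝ)) (b := 1 / 2) (by norm_num) (by norm_num) (by norm_num)
  have h2 := hc h1 hp2 (a := (6 / 7 : ℝ)) (b := 1 / 7) (by norm_num) (by norm_num) (by norm_num)
  convert h2 using 1
  subst hy
  module

end Caps

/-! ### Saturated systems and the floating body -/

section Saturated

variable {d : ℕ} {K : Set (Pt d)}

/-- A compact convex part of `K` of volume more than `(d + 1) T` meets the floating body
`K(v ≥ T)`, by Helly's theorem: it is not covered by `d + 1` half-spaces cutting off less than `T`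
from `K`. -/
lemma inter_floatingBody_nonempty (hd : 0 < d) (hK : IsCompact K) {D : Set (Pt d)} (hDK : D ⊆ K)
    (hD : IsCompact D) (hDc : Convex ℝ D) {T : ℝ} (hT : 0 < T)
    (hV : (d + 1) * T < volume.real D) : (D ∩ floatingBody K T).Nonempty := by
  let ι := {p : Pt d × ℝ // p.1 ≠ 0 ∧ volume.real (K ∩ halfSpace p.1 p.2) < T}
  let F : ι → Set (Pt d) := fun i => D ∩ {x | ⟪i.1.1, x⟫ ≤ i.1.2}
  have hcl : ∀ i : ι, IsClosed {x : Pt d | ⟪i.1.1, x⟫ ≤ i.1.2} := fun i =>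
    isClosed_le (by fun_prop) continuous_const
  have hne : (⋂ i, F i).Nonempty := by
    refine Convex.helly_theorem_compact' (𝕜 := ℝ) (fun i => hDc.inter ?_)
      (fun i => hD.inter_right (hcl i)) fun I hI => ?_
    · exact convex_halfSpace_le (𝕜 := ℝ) (innerSL ℝ i.1.1).toLinearMap.isLinear _
    · rw [finrank_euclideanSpace_fin] at hI
      by_contra hemp
      have hcov : D ⊆ ⋃ i ∈ I, K ∩ halfSpace i.1.1 i.1.2 := by
        intro x hx
        by_contra hxn
        simp only [mem_iUnion, not_exists] at hxn
        refine hemp ⟨x, ?_⟩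
        simp only [mem_iInter]
        intro i hi
        refine ⟨hx, ?_⟩
        by_contra hlt
        exact hxn i hi ⟨hDK hx, le_of_lt (α := ℝ) (not_le.1 hlt)⟩
      have h1 : volume.real D ≤ ∑ i ∈ I, volume.real (K ∩ halfSpace i.1.1 i.1.2) := by
        refine (measureReal_mono hcov ?_).trans (measureReal_biUnion_finset_le _ _)
        exact ((measure_mono (iUnion₂_subset fun i _ => inter_subset_left)).trans_lt
          hK.measure_lt_top).ne
      have h2 : ∑ i ∈ I, volume.real (K ∩ halfSpace i.1.1 i.1.2) ≤ ∑ _i ∈ I, T :=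
        Finset.sum_le_sum fun i _ => i.2.2.le
      rw [Finset.sum_const, nsmul_eq_mul] at h2
      have h3 : (I.card : ℝ) ≤ d + 1 := by exact_mod_cast hI
      nlinarith
  obtain ⟨x, hx⟩ := hne
  simp only [mem_iInter] at hx
  obtain ⟨u₀, hu₀⟩ := exists_unit hd
  have hu₀' : u₀ ≠ 0 := by rintro rfl; simp at hu₀
  have hDx : x ∈ D := by
    refine (hx ⟨(u₀, supportFn K u₀ + 1), hu₀', ?_⟩).1
    have : K ∩ halfSpace u₀ (supportFn K u₀ + 1) = ∅ := by
      ext y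
      simp only [mem_inter_iff, halfSpace, mem_ofPred_eq, mem_empty_iff_false, iff_false, not_and,
        not_le]
      intro hy
      linarith [inner_le_supportFn hK u₀ hy]
    simpa [this] using hT
  refine ⟨x, hDx, hDK hDx, le_capVol hd fun u a hu hxa => ?_⟩
  by_contra! hlt
  have hev := (continuous_volume_halfSpace hK hu).continuousAt.eventually_lt
    (continuousAt_const (y := T)) hlt
  obtain ⟨a', ha', hlt'⟩ := (hev.filter_mono (nhdsWithin_le_nhds (s := Iio a))).and
    self_mem_nhdsWithin |>.exists
  have h1 : ⟪u, x⟫ ≤ a' := (hx ⟨(u, a'), hu, ha'⟩).2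
  exact absurd hxa (not_le.2 (h1.trans_lt hlt'))

/-- A half-space supporting the floating body `K(v ≥ T)` cuts off at most `(d + 1) T`. -/
lemma volume_supporting_halfSpace_le (hd : 0 < d) (hK : IsCompact K) (hc : Convex ℝ K) {T : ℝ}
    (hT : 0 < T) {u : Pt d} (hu : u ≠ 0) {a : ℝ} (h : ∀ y ∈ floatingBody K T, ⟪u, y⟫ ≤ a) :
    volume.real (K ∩ halfSpace u a) ≤ (d + 1) * T := by
  by_contra! hlt
  have hev := (continuousAt_const (y := (d + 1) * T)).eventually_lt
    (continuous_volume_halfSpace hK hu).continuousAt hlt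
  obtain ⟨a', ha', hlt'⟩ := (hev.filter_mono (nhdsWithin_le_nhds (s := Ioi a))).and
    self_mem_nhdsWithin |>.exists
  obtain ⟨y, hy, hyf⟩ := inter_floatingBody_nonempty hd hK inter_subset_left
    (hK.inter_right (isClosed_halfSpace u a')) (hc.inter (convex_halfSpace u a')) hT ha'
  have h1 : a' ≤ ⟪u, y⟫ := hy.2
  have h2 : a < a' := hlt'
  linarith [h y hyf]

lemma succ_mul_pow_lt (hd : 2 ≤ d) : (d + 1 : ℝ) * (9 / 2) ^ d < d * 6 ^ d := by
  have h1 : ((3 : ℝ) / 4) ^ d ≤ (3 / 4) ^ 2 :=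
    pow_le_pow_of_le_one (by norm_num) (by norm_num) hd
  have h2 : (9 / 2 : ℝ) ^ d = (3 / 4) ^ d * 6 ^ d := by rw [← mul_pow]; norm_num
  have hd' : (2 : ℝ) ≤ d := by exact_mod_cast hd
  rw [h2, ← mul_assoc]
  refine mul_lt_mul_of_pos_right ?_ (by positivity)
  nlinarith

/-- Every closed half-space through a point of `K(v ≥ d 6^d T)` contains one of the half Macbeath
regions of a saturated system on `K(v = T)` in its interior. The region is found near the point at
which a parallel hyperplane touches `K(v ≥ T)`. -/
lemma SaturatedSystem.exists_half_beyond (hd : 2 ≤ d) (hK : IsCompact K) (hc : Convex ℝ K)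
    {T : ℝ} (hT : 0 < T) (hV : (d + 1) * T < volume.real K) (Y : SaturatedSystem K T)
    {x : Pt d} (hx : x ∈ floatingBody K (d * 6 ^ d * T)) {u : Pt d} (hu : u ≠ 0) :
    ∃ j, ∀ p ∈ Y.half j, ⟪u, x⟫ < ⟪u, p⟫ := by
  have hd0 : 0 < d := by omega
  obtain ⟨z₀, -, hz₀⟩ := inter_floatingBody_nonempty hd0 hK subset_rfl hK hc hT hV
  obtain ⟨z, hz, hmax⟩ := (isCompact_floatingBody hd0 hK T).exists_isMaxOn ⟨z₀, hz₀⟩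
    (f := fun y => ⟪u, y⟫) (by fun_prop)
  have hmax' : ∀ y ∈ floatingBody K T, ⟪u, y⟫ ≤ ⟪u, z⟫ := fun y hy => hmax hy
  have hun : 0 < ⟪u, u⟫ := real_inner_self_pos.2 hu
  have hzb : z ∈ floatingBoundary K T := by
    refine ⟨subset_closure hz, fun hint => ?_⟩
    have hlim : Filter.Tendsto (fun κ : ℝ => z + κ • u) (nhdsWithin 0 (Ioi 0)) (nhds z) := by
      have : Continuous fun κ : ℝ => z + κ • u := by fun_prop
      simpa using (this.tendsto 0).mono_left nhdsWithin_le_nhds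
    obtain ⟨κ, hκ, hκ0⟩ := ((hlim.eventually (mem_interior_iff_mem_nhds.1 hint)).and
      self_mem_nhdsWithin).exists
    have h1 := hmax' _ hκ
    have h2 : 0 < κ := hκ0
    rw [inner_add_right, inner_smul_right] at h1
    have := mul_pos h2 hun
    linarith
  obtain ⟨j, hj⟩ := Y.maximal z hzb
  refine ⟨j, fun p hp => ?_⟩
  by_contra! hle
  have hpK := reflection_mem_of_macbeath_inter hc hj hp.1
  have h1 := inner_le_supportFn hK u hpK
  rw [inner_sub_right, inner_smul_right, inner_sub_right] at h1
  set τ := supportFn K u - ⟪u, z⟫ with hτ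
  have hτcap : cap K u τ = K ∩ halfSpace u ⟪u, z⟫ := by simp [cap, hτ]
  have hsub : K ∩ halfSpace u ⟪u, x⟫ ⊆ cap K u (9 / 2 * τ) := by
    rintro y ⟨hyK, hy⟩
    have hy' : ⟪u, x⟫ ≤ ⟪u, y⟫ := hy
    refine ⟨hyK, ?_⟩
    simp only [halfSpace, mem_ofPred_eq]
    linarith
  have h2 : d * 6 ^ d * T ≤ volume.real (K ∩ halfSpace u ⟪u, x⟫) :=
    hx.2.trans (capVol_le hu (le_refl (α := ℝ) _))
  have h3 : volume.real (K ∩ halfSpace u ⟪u, x⟫) ≤ volume.real (cap K u (9 / 2 * τ)) :=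
    measureReal_mono hsub (volume_inter_ne_top hK _)
  have h4 := volume_cap_mul_le hK hc ⟨x, hx.1⟩ u τ (lam := 9 / 2) (by norm_num)
  have h5 := volume_supporting_halfSpace_le hd0 hK hc hT hu hmax'
  rw [← hτcap] at h5
  have h6 : (9 / 2 : ℝ) ^ d * volume.real (cap K u τ) ≤ (9 / 2) ^ d * ((d + 1) * T) := by gcongr
  have h7 := mul_lt_mul_of_pos_right (succ_mul_pow_lt hd) hT
  linarith

/-- A set that meets all half Macbeath regions of a saturated system on `K(v = T)` contains
`K(v ≥ d 6^d T)` in its convex hull. -/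
lemma SaturatedSystem.floatingBody_subset_convexHull (hd : 2 ≤ d) (hK : IsCompact K)
    (hc : Convex ℝ K) {T : ℝ} (hT : 0 < T) (hV : (d + 1) * T < volume.real K)
    (Y : SaturatedSystem K T) {Q : Set (Pt d)} (hQ : ∀ j, (Q ∩ Y.half j).Nonempty) :
    floatingBody K (d * 6 ^ d * T) ⊆ convexHull ℝ (Q ∩ K) := by
  intro x hx
  choose q hq using hQ
  have hsub : range q ⊆ Q ∩ K := by
    rintro _ ⟨j, rfl⟩; exact ⟨(hq j).1, (hq j).2.2.1⟩
  refine convexHull_mono hsub ?_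
  by_contra hnot
  obtain ⟨w, s, hw1, hw2⟩ := exists_inner_lt_of_notMem (convex_convexHull ℝ (range q))
    ((finite_range q).isClosed_convexHull ℝ) hnot
  have hqs : ∀ j, ⟪w, q j⟫ < s := fun j => hw1 _ (subset_convexHull ℝ _ ⟨j, rfl⟩)
  by_cases hw : w = 0
  · subst hw
    obtain ⟨u, hu⟩ := exists_unit (show 0 < d by omega)
    obtain ⟨j, -⟩ := Y.exists_half_beyond hd hK hc hT hV hx (u := u) (by rintro rfl; simp at hu)
    have := hqs j
    simp only [inner_zero_left] at this hw2
    linarith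
  · obtain ⟨j, hj⟩ := Y.exists_half_beyond hd hK hc hT hV hx hw
    have := hj _ (hq j).2
    linarith [hqs j]

end Saturated

/-! ### Faces and flags of polytopes -/

section Faces

variable {d : ℕ}

open scoped Classical in
/-- The average of the points of `V` lying in `F`. -/
def faceCenter (V : Finset (Pt d)) (F : Set (Pt d)) : Pt d :=
  ((V.filter (· ∈ F)).card : ℝ)⁻¹ • ∑ v ∈ V.filter (· ∈ F), v

lemma average_mem {W : Finset (Pt d)} (hW : W.Nonempty) {C : Set (Pt d)} (hC : Convex ℝ C)
    (h : ∀ v ∈ W, v ∈ C) : (W.card : ℝ)⁻¹ • ∑ v ∈ W, v ∈ C := by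
  have hcard : (0 : ℝ) < W.card := by exact_mod_cast hW.card_pos
  rw [Finset.smul_sum]
  refine hC.sum_mem (fun _ _ => by positivity) ?_ h
  rw [Finset.sum_const, nsmul_eq_mul, mul_inv_cancel₀ hcard.ne']

/-- An exposed face of a polytope is the convex hull of the generating points it contains. -/
lemma exposed_eq_convexHull (V : Finset (Pt d)) {F : Set (Pt d)}
    (hF : IsExposed ℝ (convexHull ℝ (V : Set (Pt d))) F) :
    F = convexHull ℝ ((V : Set (Pt d)) ∩ F) := by
  have hc : Convex ℝ F := hF.convex (convex_convexHull ℝ _)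
  have hK : IsCompact F := hF.isCompact (V.finite_toSet.isCompact_convexHull ℝ)
  refine subset_antisymm ?_ (convexHull_min inter_subset_right hc)
  have hfin : ((V : Set (Pt d)) ∩ F).Finite := V.finite_toSet.subset inter_subset_left
  nth_rewrite 1 [← closure_convexHull_extremePoints hK hc]
  refine closure_minimal (convexHull_mono fun x hx => ⟨?_, extremePoints_subset hx⟩)
    (hfin.isClosed_convexHull ℝ)
  exact extremePoints_convexHull_subset (hF.isExtreme.extremePoints_subset_extremePoints hx)

/-- For polytopes, an exposed face of an exposed face is an exposed face. -/
lemma exposed_trans (V : Finset (Pt d)) {F G : Set (Pt d)}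
    (hF : IsExposed ℝ (convexHull ℝ (V : Set (Pt d))) F) (hG : IsExposed ℝ F G) :
    IsExposed ℝ (convexHull ℝ (V : Set (Pt d))) G := by
  intro hGne
  obtain ⟨g, hg⟩ := hGne
  obtain ⟨l₂, h₂⟩ := hG ⟨g, hg⟩
  have hgF : g ∈ F := hG.subset hg
  obtain ⟨l₁, h₁⟩ := hF ⟨g, hgF⟩
  have hgc : Convex ℝ G := hG.convex (hF.convex (convex_convexHull ℝ _))
  set P := convexHull ℝ (V : Set (Pt d)) with hP
  have hVP : ∀ v ∈ V, v ∈ P := fun v hv => subset_convexHull ℝ _ hv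
  have hF1 : ∀ x ∈ F, l₁ x = l₁ g := fun x hx => by
    rw [h₁] at hx hgF
    exact le_antisymm (hgF.2 x hx.1) (hx.2 g hgF.1)
  have hF2 : ∀ x ∈ P, l₁ x ≤ l₁ g := fun x hx => by rw [h₁] at hgF; exact hgF.2 x hx
  have hF3 : ∀ x ∈ P, l₁ x = l₁ g → x ∈ F := fun x hx he => by
    rw [h₁]; exact ⟨hx, fun y hy => by rw [he]; exact hF2 y hy⟩
  have hG2 : ∀ x ∈ F, l₂ x ≤ l₂ g := fun x hx => by rw [h₂] at hg; exact hg.2 x hx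
  have hG3 : ∀ x ∈ F, l₂ x = l₂ g → x ∈ G := fun x hx he => by
    rw [h₂]; exact ⟨hx, fun y hy => by rw [he]; exact hG2 y hy⟩
  -- a large multiple of `l₁`, perturbed by `l₂`, exposes `G`
  have hN : ∀ᶠ N : ℝ in Filter.atTop, ∀ v ∈ V, v ∉ F → l₂ v - l₂ g < N * (l₁ g - l₁ v) := by
    rw [Filter.eventually_all_finset]
    intro v hv
    by_cases hvF : v ∈ F
    · exact .of_forall fun _ h => absurd hvF h
    · have hpos : 0 < l₁ g - l₁ v := by
        have := lt_of_le_of_ne (hF2 v (hVP v hv)) fun he => hvF (hF3 v (hVP v hv) he)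
        linarith
      filter_upwards [(Filter.tendsto_id.atTop_mul_const hpos).eventually_gt_atTop (l₂ v - l₂ g)]
        with N hN _ using hN
  obtain ⟨N, hN⟩ := hN.exists
  set l : StrongDual ℝ (Pt d) := N • l₁ + l₂ with hl
  have hlv : ∀ x, l x = N * l₁ x + l₂ x := fun x => by simp [hl]
  have hV : ∀ v ∈ V, l v ≤ l g ∧ (l v = l g → v ∈ G) := by
    intro v hv
    by_cases hvF : v ∈ F
    · rw [hlv, hlv, hF1 v hvF]
      refine ⟨by linarith [hG2 v hvF], fun he => hG3 v hvF (by linarith)⟩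
    · have := hN v hv hvF
      rw [hlv, hlv]
      exact ⟨by linarith, fun he => by linarith⟩
  have hle : ∀ x ∈ P, l x ≤ l g := fun x hx =>
    convexHull_min (fun v hv => (hV v hv).1)
      (convex_halfSpace_le (𝕜 := ℝ) l.toLinearMap.isLinear (l g)) hx
  refine ⟨l, subset_antisymm (fun x hx => ?_) fun x hx => ?_⟩
  · have hxF : x ∈ F := hG.subset hx
    have h2 : l₂ x = l₂ g := by
      rw [h₂] at hx hg
      exact le_antisymm (hg.2 x hx.1) (hx.2 g hg.1)
    refine ⟨hF.subset hxF, fun y hy => ?_⟩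
    rw [show l x = l g by rw [hlv, hlv, hF1 x hxF, h2]]
    exact hle y hy
  · have hexp : IsExposed ℝ P {x ∈ P | ∀ y ∈ P, l y ≤ l x} := fun _ => ⟨l, rfl⟩
    rw [exposed_eq_convexHull V hexp] at hx
    refine convexHull_min ?_ hgc hx
    rintro v ⟨hv, hv1, hv2⟩
    exact (hV v hv).2 (le_antisymm (hV v hv).1 (hv2 g (hF.subset hgF)))

/-- If `x'` is the last point of `Q` on the ray from `p` through `x'`, then `Q` has a supporting
hyperplane at `x'` whose normal lies in the direction space of `Q`. -/
lemma exists_supporting_normal {Q : Set (Pt d)} (hQ : IsClosed Q) (hc : Convex ℝ Q)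
    {p x' : Pt d} (hp : p ∈ Q) (hx' : x' ∈ Q)
    (hexit : ∀ n : ℕ, x' + (1 / ((n : ℝ) + 1)) • (x' - p) ∉ Q) :
    ∃ w ∈ vectorSpan ℝ Q, w ≠ 0 ∧ ∀ q ∈ Q, ⟪w, q - x'⟫ ≤ 0 := by
  set y : ℕ → Pt d := fun n => x' + (1 / ((n : ℝ) + 1)) • (x' - p) with hy
  have hpt : ∀ n, ∃ w ∈ vectorSpan ℝ Q, ‖w‖ = 1 ∧ ∀ q ∈ Q, ⟪w, q - y n⟫ ≤ 0 := by
    intro n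
    obtain ⟨q₀, hq₀, hmin⟩ :=
      exists_norm_eq_iInf_of_complete_convex ⟨p, hp⟩ hQ.isComplete hc (y n)
    rw [norm_eq_iInf_iff_real_inner_le_zero hc hq₀] at hmin
    have hne : y n - q₀ ≠ 0 := fun h => hexit n (by
      have : y n = q₀ := sub_eq_zero.1 h
      rw [← this] at hq₀; exact hq₀)
    have hn : 0 < ‖y n - q₀‖ := norm_pos_iff.2 hne
    refine ⟨‖y n - q₀‖⁻¹ • (y n - q₀), Submodule.smul_mem _ _ ?_, ?_, fun q hq => ?_⟩
    · have : y n - q₀ = (x' - q₀) + (1 / ((n : ℝ) + 1)) • (x' - p) := by simp only [hy]; abel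
      rw [this]
      exact Submodule.add_mem _ (vsub_mem_vectorSpan ℝ hx' hq₀)
        (Submodule.smul_mem _ _ (vsub_mem_vectorSpan ℝ hx' hp))
    · rw [norm_smul, norm_inv, norm_norm, inv_mul_cancel₀ hn.ne']
    · rw [inner_smul_left, RCLike.conj_to_real]
      refine mul_nonpos_of_nonneg_of_nonpos (by positivity) ?_
      have h1 := hmin q hq
      have h2 : 0 ≤ ⟪y n - q₀, y n - q₀⟫ := real_inner_self_nonneg
      have h3 : q - y n = (q - q₀) - (y n - q₀) := by abel
      rw [h3, inner_sub_right]; linarith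
  choose w hwL hw1 hwQ using hpt
  obtain ⟨w₀, hw₀, φ, hφ, hlim⟩ := (isCompact_sphere (0 : Pt d) 1).tendsto_subseq
    (x := w) (fun n => by simp [hw1 n])
  refine ⟨w₀, ?_, ?_, fun q hq => ?_⟩
  · exact (Submodule.closed_of_finiteDimensional (vectorSpan ℝ Q)).mem_of_tendsto hlim
      (.of_forall fun n => hwL _)
  · rintro rfl; simp at hw₀
  · have hylim : Filter.Tendsto y Filter.atTop (nhds x') := by
      have := (tendsto_one_div_add_atTop_nhds_zero_nat (𝕜 := ℝ)).smul_const (x' - p)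
      simpa [hy] using this.const_add x'
    exact le_of_tendsto' (hlim.inner ((tendsto_const_nhds (x := q)).sub
      (hylim.comp hφ.tendsto_atTop))) fun n => hwQ _ q hq

lemma eq_zero_of_inner_const {W : Finset (Pt d)} {x' m : Pt d}
    (hm : m ∈ vectorSpan ℝ (convexHull ℝ (W : Set (Pt d))))
    (h : ∀ v ∈ W, ⟪m, v - x'⟫ = 0) : m = 0 := by
  rw [← direction_affineSpan, affineSpan_convexHull, direction_affineSpan] at hm
  have hle : vectorSpan ℝ (W : Set (Pt d)) ≤ (ℝ ∙ m)ᗮ := by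
    rw [vectorSpan_def, Submodule.span_le]
    rintro _ ⟨v, hv, v', hv', rfl⟩
    rw [SetLike.mem_coe, Submodule.mem_orthogonal_singleton_iff_inner_right]
    have : v -ᵥ v' = (v - x') - (v' - x') := by simp
    simp only [this, inner_sub_right m (v - x'), h v hv, h v' hv', sub_zero]
  exact inner_self_eq_zero.1 (Submodule.mem_orthogonal_singleton_iff_inner_right.1 (hle hm))

/-- The facets of a polytope `Q = conv W`: if some hyperplane supports `Q` at `x'` and does not
contain `p ∈ Q`, then `Q` has a facet containing `x'`. A supporting hyperplane
through `x'` that avoids `p` and contains as many points of `W` as possible cuts out a facet, for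
otherwise it could be rotated until it contains one more point of `W`. -/
lemma exists_facet {W : Finset (Pt d)} {k : ℕ}
    (hk : Module.finrank ℝ (vectorSpan ℝ (convexHull ℝ (W : Set (Pt d)))) = k + 1)
    {p x' w₀ : Pt d} (hp : p ∈ convexHull ℝ (W : Set (Pt d)))
    (hx' : x' ∈ convexHull ℝ (W : Set (Pt d)))
    (hw₀ : w₀ ∈ vectorSpan ℝ (convexHull ℝ (W : Set (Pt d))))
    (hw₀W : ∀ v ∈ W, ⟪w₀, v - x'⟫ ≤ 0) (hw₀p : ⟪w₀, p - x'⟫ < 0) :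
    ∃ G, IsExposed ℝ (convexHull ℝ (W : Set (Pt d))) G ∧ x' ∈ G ∧
      Module.finrank ℝ (vectorSpan ℝ G) = k := by
  classical
  set Q := convexHull ℝ (W : Set (Pt d)) with hQ
  set L := vectorSpan ℝ Q with hL
  let good : Set (Pt d) := {w | w ∈ L ∧ (∀ v ∈ W, ⟪w, v - x'⟫ ≤ 0) ∧ ⟪w, p - x'⟫ < 0}
  let N : Pt d → ℕ := fun w => (W.filter fun v => ⟪w, v - x'⟫ = 0).card
  obtain ⟨w, ⟨hwL, hwW, hwp⟩, hwmax⟩ : ∃ w ∈ good, ∀ w' ∈ good, N w' ≤ N w := by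
    have hb : BddAbove (N '' good) := by
      refine ⟨W.card, ?_⟩
      rintro _ ⟨w, -, rfl⟩; exact Finset.card_filter_le _ _
    obtain ⟨w, hw, he⟩ := Nat.sSup_mem (s := N '' good) ⟨_, w₀, ⟨hw₀, hw₀W, hw₀p⟩, rfl⟩ hb
    exact ⟨w, hw, fun w' hw' => by rw [he]; exact le_csSup hb ⟨w', hw', rfl⟩⟩
  have hle : ∀ q ∈ Q, ⟪w, q⟫ ≤ ⟪w, x'⟫ := fun q hq =>
    convexHull_min (fun v hv => by
        have := hwW v hv
        rw [inner_sub_right] at this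
        show ⟪w, v⟫ ≤ ⟪w, x'⟫
        linarith)
      (convex_halfSpace_le (𝕜 := ℝ) (innerSL ℝ w).toLinearMap.isLinear ⟪w, x'⟫) hq
  set G : Set (Pt d) := {q ∈ Q | ∀ y ∈ Q, innerSL ℝ w y ≤ innerSL ℝ w q} with hG
  have hxG : x' ∈ G := ⟨hx', hle⟩
  have hGw : ∀ q ∈ G, ⟪w, q⟫ = ⟪w, x'⟫ := fun q hq => le_antisymm (hle q hq.1) (hq.2 x' hx')
  have hwG : vectorSpan ℝ G ≤ (ℝ ∙ w)ᗮ := by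
    rw [vectorSpan_def, Submodule.span_le]
    rintro _ ⟨q, hq, q', hq', rfl⟩
    rw [SetLike.mem_coe, Submodule.mem_orthogonal_singleton_iff_inner_right]
    simp only [vsub_eq_sub, inner_sub_right, hGw q hq, hGw q' hq', sub_self]
  refine ⟨G, fun _ => ⟨innerSL ℝ w, rfl⟩, hxG, ?_⟩
  set A := vectorSpan ℝ G ⊔ (ℝ ∙ (p - x')) with hA
  have hAL : A ≤ L := by
    refine sup_le (vectorSpan_mono ℝ fun q hq => hq.1) ?_
    rw [Submodule.span_singleton_le_iff_mem]
    exact vsub_mem_vectorSpan ℝ hp hx'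
  have hAeq : A = L := by
    by_contra hne
    have hex : ∃ m ∈ Aᗮ ⊓ L, m ≠ 0 := by
      by_contra! hno
      have hbot : Aᗮ ⊓ L = ⊥ := (Submodule.eq_bot_iff _).2 hno
      have := Submodule.sup_orthogonal_inf_of_hasOrthogonalProjection hAL
      rw [hbot, sup_bot_eq] at this
      exact hne this
    have hex' : ∃ m ∈ Aᗮ ⊓ L, ∃ v ∈ W, 0 < ⟪m, v - x'⟫ := by
      obtain ⟨m, hm, hm0⟩ := hex
      have : ∃ v ∈ W, ⟪m, v - x'⟫ ≠ 0 := by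
        by_contra! hno
        exact hm0 (eq_zero_of_inner_const hm.2 hno)
      obtain ⟨v, hv, hv0⟩ := this
      rcases lt_or_gt_of_ne hv0 with h | h
      · exact ⟨-m, Submodule.neg_mem _ hm, v, hv, by rw [inner_neg_left]; linarith⟩
      · exact ⟨m, hm, v, hv, h⟩
    obtain ⟨m, ⟨hmA, hmL⟩, v₁, hv₁, hv₁pos⟩ := hex'
    have hmG : ∀ q ∈ G, ⟪m, q - x'⟫ = 0 := fun q hq => by
      rw [real_inner_comm]
      exact (Submodule.mem_orthogonal _ _).1 hmA _
        ((le_sup_left : _ ≤ A) (vsub_mem_vectorSpan ℝ hq hxG))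
    have hmp : ⟪m, p - x'⟫ = 0 := by
      rw [real_inner_comm]
      exact (Submodule.mem_orthogonal _ _).1 hmA _
        ((le_sup_right : _ ≤ A) (Submodule.mem_span_singleton_self _))
    obtain ⟨v₀, hv₀, hmin⟩ := (W.filter fun v => 0 < ⟪m, v - x'⟫).exists_min_image
      (fun v => -⟪w, v - x'⟫ / ⟪m, v - x'⟫) ⟨v₁, Finset.mem_filter.2 ⟨hv₁, hv₁pos⟩⟩
    rw [Finset.mem_filter] at hv₀
    set s : ℝ := -⟪w, v₀ - x'⟫ / ⟪m, v₀ - x'⟫ with hs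
    have hs0 : 0 ≤ s := div_nonneg (by linarith [hwW v₀ hv₀.1]) hv₀.2.le
    have hval : ∀ v, ⟪w + s • m, v - x'⟫ = ⟪w, v - x'⟫ + s * ⟪m, v - x'⟫ := fun v => by
      simp [inner_add_left, inner_smul_left]
    have hnew : ∀ v ∈ W, ⟪w + s • m, v - x'⟫ ≤ 0 := by
      intro v hv
      rw [hval]
      rcases le_or_gt ⟪m, v - x'⟫ 0 with h | h
      · have := hwW v hv
        have := mul_nonpos_of_nonneg_of_nonpos hs0 h
        linarith
      · have := hmin v (Finset.mem_filter.2 ⟨hv, h⟩)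
        rw [le_div_iff₀ h] at this
        linarith
    have hgood : w + s • m ∈ good :=
      ⟨Submodule.add_mem _ hwL (Submodule.smul_mem _ _ hmL), hnew, by rw [hval, hmp]; linarith⟩
    have hmemG : ∀ v ∈ W, ⟪w, v - x'⟫ = 0 → v ∈ G := fun v hv h =>
      ⟨subset_convexHull ℝ _ hv, fun y hy => by
        rw [inner_sub_right] at h
        show ⟪w, y⟫ ≤ ⟪w, v⟫
        linarith [hle y hy]⟩
    refine absurd (hwmax _ hgood) (not_le.2 (Finset.card_lt_card ?_))
    rw [Finset.ssubset_iff_of_subset]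
    · refine ⟨v₀, Finset.mem_filter.2 ⟨hv₀.1, ?_⟩, fun h => ?_⟩
      · rw [hval, hs, div_mul_cancel₀ _ hv₀.2.ne']; ring
      · exact hv₀.2.ne' (hmG v₀ (hmemG v₀ hv₀.1 (Finset.mem_filter.1 h).2))
    · intro v hv
      rw [Finset.mem_filter] at hv ⊢
      refine ⟨hv.1, ?_⟩
      rw [hval, hv.2, hmG v (hmemG v hv.1 hv.2)]; ring
  have hdisj : vectorSpan ℝ G ⊓ (ℝ ∙ (p - x')) = ⊥ := by
    rw [Submodule.eq_bot_iff]
    rintro q ⟨hq1, hq2⟩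
    obtain ⟨c, rfl⟩ := Submodule.mem_span_singleton.1 hq2
    have h := Submodule.mem_orthogonal_singleton_iff_inner_right.1 (hwG hq1)
    rw [inner_smul_right] at h
    rcases mul_eq_zero.1 h with h | h
    · rw [h, zero_smul]
    · exact absurd h hwp.ne
  have hpx : p - x' ≠ 0 := by
    intro h; rw [h, inner_zero_right] at hwp; exact lt_irrefl _ hwp
  have hrank := Submodule.finrank_sup_add_finrank_inf_eq (vectorSpan ℝ G) (ℝ ∙ (p - x'))
  rw [hdisj, finrank_bot, finrank_span_singleton hpx, ← hA, hAeq, hk] at hrank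
  omega

/-- A polytope is the union of the cones over its facets with apex the average of the vertices. -/
lemma exists_facet_segment {W : Finset (Pt d)} (hW : W.Nonempty) {k : ℕ}
    (hk : Module.finrank ℝ (vectorSpan ℝ (convexHull ℝ (W : Set (Pt d)))) = k + 1)
    {x : Pt d} (hx : x ∈ convexHull ℝ (W : Set (Pt d))) :
    ∃ G, IsExposed ℝ (convexHull ℝ (W : Set (Pt d))) G ∧
      Module.finrank ℝ (vectorSpan ℝ G) = k ∧
      ∃ x' ∈ G, x ∈ segment ℝ ((W.card : ℝ)⁻¹ • ∑ v ∈ W, v) x' := by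
  set Q := convexHull ℝ (W : Set (Pt d)) with hQ
  have hQK : IsCompact Q := W.finite_toSet.isCompact_convexHull ℝ
  have hQc : Convex ℝ Q := convex_convexHull ℝ _
  set p : Pt d := (W.card : ℝ)⁻¹ • ∑ v ∈ W, v with hp
  have hpQ : p ∈ Q := average_mem hW hQc fun v hv => subset_convexHull ℝ _ hv
  -- replace `x` by another point of `Q` if it is equal to `p`
  obtain ⟨y, hyQ, hyp, hxy⟩ : ∃ y ∈ Q, y ≠ p ∧ x ∈ segment ℝ p y := by
    by_cases h : x = p
    · obtain ⟨y, hy, hyp⟩ : ∃ y ∈ Q, y ≠ p := by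
        by_contra! hno
        have hsub : Q.Subsingleton := fun a ha b hb => (hno a ha).trans (hno b hb).symm
        rw [vectorSpan_of_subsingleton ℝ hsub, finrank_bot] at hk
        omega
      exact ⟨y, hy, hyp, h ▸ left_mem_segment ℝ p y⟩
    · exact ⟨x, hx, h, right_mem_segment ℝ p x⟩
  set S : Set ℝ := {s | 0 ≤ s ∧ p + s • (y - p) ∈ Q} with hS
  have hyp0 : 0 < ‖y - p‖ := norm_pos_iff.2 (sub_ne_zero.2 hyp)
  have hSK : IsCompact S := by
    refine Metric.isCompact_of_isClosed_isBounded ?_ ?_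
    · exact isClosed_Ici.inter (hQK.isClosed.preimage (by fun_prop))
    · obtain ⟨R, hR⟩ := hQK.isBounded.subset_closedBall p
      refine (Metric.isBounded_Icc (0 : ℝ) (R / ‖y - p‖)).subset ?_
      rintro s ⟨hs0, hs⟩
      refine ⟨hs0, ?_⟩
      have := hR hs
      rw [Metric.mem_closedBall, dist_eq_norm, add_sub_cancel_left, norm_smul,
        Real.norm_of_nonneg hs0] at this
      rwa [le_div_iff₀ hyp0]
  have h1S : (1 : ℝ) ∈ S := ⟨zero_le_one, by simpa using hyQ⟩
  obtain ⟨s, ⟨hs0, hsQ⟩, hmax⟩ := hSK.exists_isGreatest ⟨1, h1S⟩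
  have hs1 : 1 ≤ s := hmax h1S
  set x' := p + s • (y - p) with hx'
  have hexit : ∀ n : ℕ, x' + (1 / ((n : ℝ) + 1)) • (x' - p) ∉ Q := by
    intro n hn
    have h1 : x' + (1 / ((n : ℝ) + 1)) • (x' - p) =
        p + (s + 1 / ((n : ℝ) + 1) * s) • (y - p) := by
      rw [hx']; module
    rw [h1] at hn
    have hpos : 0 < 1 / ((n : ℝ) + 1) * s := by positivity
    have := hmax ⟨by positivity, hn⟩
    linarith
  obtain ⟨w, hwL, hw0, hwQ⟩ := exists_supporting_normal hQK.isClosed hQc hpQ hsQ hexit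
  have hwW : ∀ v ∈ W, ⟪w, v - x'⟫ ≤ 0 := fun v hv => hwQ v (subset_convexHull ℝ _ hv)
  have hwp : ⟪w, p - x'⟫ < 0 := by
    have hcard : (0 : ℝ) < W.card := by exact_mod_cast hW.card_pos
    have hav : p - x' = (W.card : ℝ)⁻¹ • ∑ v ∈ W, (v - x') := by
      rw [Finset.sum_sub_distrib, Finset.sum_const, smul_sub, ← hp, ← Nat.cast_smul_eq_nsmul ℝ,
        inv_smul_smul₀ hcard.ne']
    rw [hav, inner_smul_right, inner_sum]
    refine mul_neg_of_pos_of_neg (by positivity) ?_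
    by_contra! hge
    have hall := (Finset.sum_eq_zero_iff_of_nonpos hwW).1 (le_antisymm (Finset.sum_nonpos hwW) hge)
    exact hw0 (eq_zero_of_inner_const hwL hall)
  obtain ⟨G, hG, hxG, hrank⟩ := exists_facet hk hpQ hsQ hwL hwW hwp
  refine ⟨G, hG, hrank, x', hxG, ?_⟩
  obtain ⟨a, b, ha, hb, hab, rfl⟩ := hxy
  have hs0' : (0 : ℝ) < s := by linarith
  refine ⟨1 - b / s, b / s, ?_, by positivity, by ring, ?_⟩
  · have : b / s ≤ 1 := by rw [div_le_one hs0']; linarith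
    linarith
  · have h1 : a = 1 - b := by linarith
    have h2 : (b / s) • x' = (b / s) • p + b • (y - p) := by
      rw [hx', smul_add, smul_smul _ s, div_mul_cancel₀ _ hs0'.ne']
    rw [h2, h1]
    module

lemma faceCenter_mem (V : Finset (Pt d)) {F : Set (Pt d)}
    (hF : IsExposed ℝ (convexHull ℝ (V : Set (Pt d))) F) (hne : F.Nonempty) :
    faceCenter V F ∈ F := by
  classical
  have hne' : (V.filter (· ∈ F)).Nonempty := by
    rw [exposed_eq_convexHull V hF, convexHull_nonempty_iff] at hne
    obtain ⟨v, hv, hvF⟩ := hne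
    exact ⟨v, Finset.mem_filter.2 ⟨hv, hvF⟩⟩
  exact average_mem hne' (hF.convex (convex_convexHull ℝ _)) fun v hv => (Finset.mem_filter.1 hv).2

/-- The barycentric subdivision of a face: each of its points lies in the simplex spanned by the
centres of a chain of faces of all dimensions. -/
lemma exists_chain_mem_convexHull (V : Finset (Pt d)) (k : ℕ) :
    ∀ Q : Set (Pt d), IsExposed ℝ (convexHull ℝ (V : Set (Pt d))) Q → Q.Nonempty →
      Module.finrank ℝ (vectorSpan ℝ Q) = k → ∀ x ∈ Q, ∃ F : ℕ → Set (Pt d),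
        (∀ i ≤ k, (F i).Nonempty ∧ IsExposed ℝ (convexHull ℝ (V : Set (Pt d))) (F i) ∧
          Module.finrank ℝ (vectorSpan ℝ (F i)) = i) ∧
        (∀ i j, i ≤ j → j ≤ k → F i ⊆ F j) ∧ F k = Q ∧
        x ∈ convexHull ℝ ((fun i => faceCenter V (F i)) '' Iic k) := by
  classical
  induction k with
  | zero =>
    intro Q hQ hne hk x hx
    refine ⟨fun _ => Q, ?_, fun _ _ _ _ => subset_rfl, rfl, ?_⟩
    · intro i hi
      obtain rfl : i = 0 := by omega
      exact ⟨hne, hQ, hk⟩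
    · have hxc : x = faceCenter V Q := by
        have h1 := vsub_mem_vectorSpan ℝ hx (faceCenter_mem V hQ hne)
        rw [Submodule.finrank_eq_zero.1 hk, Submodule.mem_bot, vsub_eq_zero_iff_eq] at h1
        exact h1
      rw [hxc]
      exact subset_convexHull ℝ _ ⟨0, by simp, rfl⟩
  | succ k ih =>
    intro Q hQ hne hk x hx
    set W := V.filter (· ∈ Q) with hW
    have hWQ : convexHull ℝ (W : Set (Pt d)) = Q := by
      conv_rhs => rw [exposed_eq_convexHull V hQ]
      congr 1
      ext v; simp [hW]
    have hWne : W.Nonempty := by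
      rw [← hWQ, convexHull_nonempty_iff] at hne
      exact_mod_cast hne
    obtain ⟨G, hG, hGk, x', hx'G, hseg⟩ := exists_facet_segment hWne (by rw [hWQ, hk])
      (x := x) (by rw [hWQ]; exact hx)
    rw [hWQ] at hG
    obtain ⟨F, hF1, hF2, hF3, hF4⟩ := ih G (exposed_trans V hQ hG) ⟨x', hx'G⟩ hGk x' hx'G
    have hupd : ∀ i ≤ k, Function.update F (k + 1) Q i = F i := fun i hi =>
      Function.update_of_ne (by omega) _ _
    refine ⟨Function.update F (k + 1) Q, ?_, ?_, by simp, ?_⟩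
    · intro i hi
      rcases Nat.le_succ_iff.1 hi with h | rfl
      · rw [hupd i h]; exact hF1 i h
      · rw [Function.update_self]; exact ⟨hne, hQ, hk⟩
    · intro i j hij hj
      rcases Nat.le_succ_iff.1 hj with h | rfl
      · rw [hupd j h, hupd i (hij.trans h)]; exact hF2 i j hij h
      · rcases Nat.le_succ_iff.1 hij with h' | rfl
        · rw [hupd i h']
          simpa using ((hF2 i k h' le_rfl).trans hF3.subset).trans hG.subset
        · exact subset_rfl
    · refine (convex_convexHull ℝ _).segment_subset (x := faceCenter V Q) ?_ ?_ hseg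
      · exact subset_convexHull ℝ _ ⟨k + 1, by simp, by simp⟩
      · refine convexHull_mono ?_ hF4
        rintro _ ⟨i, hi, rfl⟩
        exact ⟨i, le_trans (show i ≤ k from hi) (Nat.le_succ k), by simp [hupd i hi]⟩

/-- The vertices of the simplex of the barycentric subdivision of `conv V` given by a flag. -/
def flagVertex (V : Finset (Pt d)) (F : Fin d → Set (Pt d)) (i : Fin (d + 1)) : Pt d :=
  if h : (i : ℕ) < d then faceCenter V (F ⟨i, h⟩)
  else faceCenter V (convexHull ℝ (V : Set (Pt d)))

lemma exists_flag_mem_convexHull (V : Finset (Pt d))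
    (hdim : Module.finrank ℝ (vectorSpan ℝ (convexHull ℝ (V : Set (Pt d)))) = d)
    {x : Pt d} (hx : x ∈ convexHull ℝ (V : Set (Pt d))) :
    ∃ F, IsFlag (convexHull ℝ (V : Set (Pt d))) F ∧
      x ∈ convexHull ℝ (range (flagVertex V F)) := by
  obtain ⟨F, h1, h2, h3, h4⟩ := exists_chain_mem_convexHull V d _ (IsExposed.refl (𝕜 := ℝ) _)
    ⟨x, hx⟩ hdim x hx
  refine ⟨fun i => F i, ⟨fun i => h1 i i.2.le, fun i j hij => h2 i j hij j.2.le⟩, ?_⟩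
  refine convexHull_mono ?_ h4
  rintro _ ⟨i, hi, rfl⟩
  have hi' : i ≤ d := hi
  refine ⟨⟨i, by omega⟩, ?_⟩
  rcases hi'.lt_or_eq with h | rfl
  · simp [flagVertex, h]
  · simp [flagVertex, h3]

lemma flagVertex_mem (V : Finset (Pt d)) (hne : V.Nonempty) {F : Fin d → Set (Pt d)}
    (hF : IsFlag (convexHull ℝ (V : Set (Pt d))) F) (i : Fin (d + 1)) :
    flagVertex V F i ∈ convexHull ℝ (V : Set (Pt d)) := by
  unfold flagVertex
  split_ifs with h
  · exact (hF.1 _).2.1.subset (faceCenter_mem V (hF.1 _).2.1 (hF.1 _).1)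
  · exact faceCenter_mem V (IsExposed.refl (𝕜 := ℝ) _) (by simpa using hne)

lemma finite_flags (V : Finset (Pt d)) :
    {F : Fin d → Set (Pt d) | IsFlag (convexHull ℝ (V : Set (Pt d))) F}.Finite := by
  have hfaces : {F : Set (Pt d) | IsExposed ℝ (convexHull ℝ (V : Set (Pt d))) F}.Finite := by
    refine (V.finite_toSet.finite_subsets.image (convexHull ℝ)).subset fun F hF => ?_
    exact ⟨_, inter_subset_left (t := F), (exposed_eq_convexHull V hF).symm⟩
  refine (Set.Finite.pi' fun _ : Fin d => hfaces).subset fun F hF i => (hF.1 i).2.1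

end Faces

/-! ### The volume of the wet part of a polytope -/

section WetPart

variable {d : ℕ}

/-- The part of the unit cube where the product of the coordinates is at most `τ`. -/
def hyperbolicCube (d : ℕ) (τ : ℝ) : Set (Fin d → ℝ) :=
  {y | (∀ i, y i ∈ Icc (0 : ℝ) 1) ∧ ∏ i, y i ≤ τ}

lemma isClosed_cube_inter_sublevel {f : (Fin d → ℝ) → ℝ} (hf : Continuous f) (t : ℝ) :
    IsClosed {y : Fin d → ℝ | (∀ i, y i ∈ Icc (0 : ℝ) 1) ∧ f y ≤ t} := by
  have h : {y : Fin d → ℝ | (∀ i, y i ∈ Icc (0 : ℝ) 1) ∧ f y ≤ t} =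
      (univ.pi fun _ => Icc (0 : ℝ) 1) ∩ {y | f y ≤ t} := by
    ext y; simp [Pi.le_def, forall_and]
  rw [h]
  exact (isClosed_set_pi fun _ _ => isClosed_Icc).inter (isClosed_le hf continuous_const)

lemma integral_indicator_rpow {θ : ℝ} (hθ : 0 < θ) :
    Integrable ((Ioc (0 : ℝ) 1).indicator fun t => t ^ (θ - 1)) ∧
      ∫ t, (Ioc (0 : ℝ) 1).indicator (fun t => t ^ (θ - 1)) t = θ⁻¹ := by
  have h1 : IntervalIntegrable (fun t : ℝ => t ^ (θ - 1)) volume 0 1 :=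
    intervalIntegral.intervalIntegrable_rpow' (by linarith)
  constructor
  · rw [integrable_indicator_iff measurableSet_Ioc]
    exact (intervalIntegrable_iff_integrableOn_Ioc_of_le zero_le_one).1 h1
  · rw [integral_indicator measurableSet_Ioc, ← intervalIntegral.integral_of_le zero_le_one,
      integral_rpow (Or.inl (by linarith)), sub_add_cancel, Real.one_rpow, Real.zero_rpow hθ.ne',
      sub_zero, one_div]

/-- Integrating out one coordinate leaves the integral of `min 1 (τ / ∏ y i)` over the remaining
ones, and `min 1 a ≤ a ^ (1 - θ)`. -/
lemma volume_hyperbolicCube_le_rpow (n : ℕ) {τ θ : ℝ} (hτ : 0 < τ) (hθ : 0 < θ) (hθ1 : θ ≤ 1) :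
    volume (hyperbolicCube (n + 1) τ) ≤ ENNReal.ofReal (τ ^ (1 - θ) * θ⁻¹ ^ n) := by
  set g : ℝ → ℝ := (Ioc (0 : ℝ) 1).indicator fun t => t ^ (θ - 1) with hg
  obtain ⟨hgi, hgv⟩ := integral_indicator_rpow hθ
  have hmp := volume_preserving_piFinSuccAbove (fun _ : Fin (n + 1) => ℝ) 0
  set R : Set (ℝ × (Fin n → ℝ)) :=
    {p | p.1 ∈ Icc (0 : ℝ) 1 ∧ (∀ i, p.2 i ∈ Icc (0 : ℝ) 1) ∧ p.1 * ∏ i, p.2 i ≤ τ} with hR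
  have hRc : IsClosed R := by
    have h : R = {p | p.1 ∈ Icc (0 : ℝ) 1} ∩ ({p | p.2 ∈ univ.pi fun _ => Icc (0 : ℝ) 1} ∩
        {p | p.1 * ∏ i, p.2 i ≤ τ}) := by
      ext p; simp [hR, Pi.le_def, forall_and]
    rw [h]
    exact (isClosed_Icc.preimage continuous_fst).inter
      (((isClosed_set_pi fun _ _ => isClosed_Icc).preimage continuous_snd).inter
        (isClosed_le (by fun_prop) continuous_const))
  have hpre : hyperbolicCube (n + 1) τ =
      MeasurableEquiv.piFinSuccAbove (fun _ : Fin (n + 1) => ℝ) 0 ⁻¹' R := by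
    ext y
    simp only [hyperbolicCube, hR, mem_preimage, mem_ofPred_eq, Fin.forall_fin_succ,
      Fin.prod_univ_succ]
    simp [MeasurableEquiv.piFinSuccAbove, Fin.insertNthEquiv, Fin.tail, and_assoc]
  rw [hpre, hmp.measure_preimage hRc.measurableSet.nullMeasurableSet, Measure.volume_eq_prod,
    Measure.prod_apply_symm hRc.measurableSet]
  have hbound : ∀ᵐ y : Fin n → ℝ, volume ((fun a => (a, y)) ⁻¹' R) ≤
      ENNReal.ofReal (τ ^ (1 - θ) * ∏ i, g (y i)) := by
    have hne : ∀ᵐ y : Fin n → ℝ, ∀ i, y i ≠ 0 := by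
      rw [ae_all_iff]; exact fun i => Measure.ae_eval_ne (μ := fun _ : Fin n => (volume : Measure ℝ)) i 0
    filter_upwards [hne] with y hy
    by_cases hmem : ∀ i, y i ∈ Icc (0 : ℝ) 1
    · have hy0 : ∀ i, 0 < y i := fun i => lt_of_le_of_ne (hmem i).1 (hy i).symm
      have hp : 0 < ∏ i, y i := Finset.prod_pos fun i _ => hy0 i
      have hsub : (fun a => (a, y)) ⁻¹' R ⊆ Icc 0 (min 1 (τ / ∏ i, y i)) := by
        rintro a ⟨ha, -, hle⟩
        exact ⟨ha.1, le_min ha.2 ((le_div_iff₀ hp).2 hle)⟩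
      refine (measure_mono hsub).trans ?_
      rw [Real.volume_Icc, sub_zero]
      refine ENNReal.ofReal_le_ofReal ?_
      have hgy : ∏ i, g (y i) = (∏ i, y i) ^ (θ - 1) := by
        rw [← Real.finsetProd_rpow _ _ fun i _ => (hy0 i).le]
        exact Finset.prod_congr rfl fun i _ => indicator_of_mem (s := Ioc (0 : ℝ) 1)
          ⟨hy0 i, (hmem i).2⟩ _
      have hq : 0 < τ / ∏ i, y i := by positivity
      have heq : τ ^ (1 - θ) * ∏ i, g (y i) = (τ / ∏ i, y i) ^ (1 - θ) := by
        rw [hgy, Real.div_rpow hτ.le hp.le, div_eq_mul_inv, ← Real.rpow_neg hp.le, neg_sub]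
      rw [heq]
      rcases le_total (τ / ∏ i, y i) 1 with h | h
      · rw [min_eq_right h]
        exact Real.self_le_rpow_of_le_one hq.le h (by linarith)
      · rw [min_eq_left h]
        exact Real.one_le_rpow h (by linarith)
    · have : (fun a => (a, y)) ⁻¹' R = ∅ := by
        ext a
        simp only [hR, mem_preimage, mem_ofPred_eq, mem_empty_iff_false, iff_false]
        exact fun h => hmem h.2.1
      simp [this]
  refine (lintegral_mono_ae hbound).trans_eq ?_
  have hint : Integrable fun y : Fin n → ℝ => ∏ i, g (y i) :=
    Integrable.fintype_prod (μ := fun _ => volume) fun _ => hgi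
  rw [← ofReal_integral_eq_lintegral_ofReal (hint.const_mul _), integral_const_mul,
    integral_fintype_prod_volume_eq_prod (fun (_ : Fin n) => g)]
  · simp [hg, hgv]
  · refine .of_forall fun y => mul_nonneg (by positivity) (Finset.prod_nonneg fun i _ => ?_)
    exact indicator_nonneg (fun t ht => Real.rpow_nonneg ht.1.le _) _

lemma volume_hyperbolicCube_le (hd : 0 < d) {τ : ℝ} (hτ : 0 < τ) :
    volume (hyperbolicCube d τ) ≤
      ENNReal.ofReal (Real.exp 1 * τ * max 1 (-Real.log τ) ^ (d - 1)) := by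
  obtain ⟨n, rfl⟩ : ∃ n, d = n + 1 := ⟨d - 1, by omega⟩
  rw [Nat.add_sub_cancel]
  rcases le_or_gt 1 (-Real.log τ) with h | h
  · have hL : 0 < -Real.log τ := by linarith
    refine (volume_hyperbolicCube_le_rpow n hτ (inv_pos.2 hL) (inv_le_one_of_one_le₀ h)).trans_eq ?_
    -- with `θ = 1 / log (1 / τ)` the factor `τ ^ (-θ)` is `exp 1`
    have : τ ^ (1 - (-Real.log τ)⁻¹) = Real.exp 1 * τ := by
      rw [Real.rpow_sub hτ, Real.rpow_one, Real.rpow_def_of_pos hτ (-Real.log τ)⁻¹,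
        show Real.log τ * (-Real.log τ)⁻¹ = -1 by
          rw [inv_neg, mul_neg, mul_inv_cancel₀ (by linarith)], Real.exp_neg, div_inv_eq_mul,
        mul_comm]
    rw [this, inv_inv, max_eq_right h]
  · rw [max_eq_left h.le, one_pow, mul_one]
    have h1 : 1 ≤ Real.exp 1 * τ := by
      rw [← Real.exp_log hτ, ← Real.exp_add]
      exact Real.one_le_exp (by linarith)
    refine le_trans ?_ (ENNReal.one_le_ofReal.2 h1)
    refine (measure_mono (t := univ.pi fun _ => Icc (0 : ℝ) 1) fun y hy i _ => hy.1 i).trans_eq ?_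
    rw [volume_pi_pi]; simp

/-- The linear map sending the `i`-th standard basis vector to `a i`. -/
def columnMap (a : Fin d → Pt d) : Pt d →ₗ[ℝ] Pt d where
  toFun y := ∑ i, y i • a i
  map_add' x y := by simp [add_smul, Finset.sum_add_distrib]
  map_smul' c x := by simp [Finset.smul_sum, smul_smul]

lemma columnMap_apply (a : Fin d → Pt d) (y : Pt d) : columnMap a y = ∑ i, y i • a i := rfl

lemma volume_image_columnMap (o : Pt d) (a : Fin d → Pt d) (S : Set (Fin d → ℝ))
    (hS : MeasurableSet S) :
    volume ((fun y : Pt d => o + columnMap a y) '' (WithLp.ofLp ⁻¹' S)) =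
      ENNReal.ofReal |LinearMap.det (columnMap a)| * volume S := by
  have h1 : (fun y : Pt d => o + columnMap a y) '' (WithLp.ofLp ⁻¹' S) =
      (fun x => o + x) '' (columnMap a '' (WithLp.ofLp ⁻¹' S)) := by
    rw [image_image]
  rw [h1, image_add_left, measure_preimage_add, Measure.addHaar_image_linearMap,
    (PiLp.volume_preserving_ofLp (Fin d)).measure_preimage hS.nullMeasurableSet]

/-- If `K` contains the simplex with vertex `o` and edge vectors `a i`, then at a point of the
simplex whose barycentric coordinate at `o` is the largest one, `v` is bounded below by the product
of the other coordinates: `K` contains a parallelepiped centred at the point. -/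
lemma le_capVol_of_simplex (hd : 0 < d) {K : Set (Pt d)} (hK : IsCompact K) {o : Pt d}
    {a : Fin d → Pt d}
    (hsub : ∀ y : Pt d, (∀ i, 0 ≤ y i) → ∑ i, y i ≤ 1 → o + columnMap a y ∈ K)
    {y : Pt d} (hy0 : ∀ i, 0 ≤ y i) (hy1 : ∀ i, y i ≤ 1 - ∑ j, y j) :
    |LinearMap.det (columnMap a)| * (2 ^ (d - 1) / d ^ d * ∏ i, y i) ≤
      capVol K (o + columnMap a y) := by
  have hd' : (1 : ℝ) ≤ d := by exact_mod_cast hd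
  refine le_capVol hd fun u r hu hx => ?_
  set D := |LinearMap.det (columnMap a)| with hD
  set S : Set (Fin d → ℝ) :=
    univ.pi fun i => Icc (y i - y i / d) (y i + y i / d) with hS
  have hSm : MeasurableSet S := MeasurableSet.univ_pi fun i => measurableSet_Icc
  have hSv : volume S = ENNReal.ofReal ((2 / d) ^ d * ∏ i, y i) := by
    rw [hS, volume_pi_pi]
    simp only [Real.volume_Icc]
    rw [← ENNReal.ofReal_prod_of_nonneg]
    · congr 1
      rw [show (2 / d : ℝ) ^ d = ∏ _i : Fin d, (2 / d : ℝ) by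
        rw [Finset.prod_const, Finset.card_univ, Fintype.card_fin], ← Finset.prod_mul_distrib]
      exact Finset.prod_congr rfl fun i _ => by ring
    · intro i _
      have := hy0 i
      have : 0 ≤ y i / d := by positivity
      linarith
  -- the half of the box that is mapped into the half-space, and its mirror image
  set φ : (Fin d → ℝ) → Pt d := fun w => o + columnMap a (WithLp.toLp 2 w) with hφ
  have hφc : Continuous φ := by
    simp only [hφ, columnMap_apply]
    fun_prop
  set S₁ : Set (Fin d → ℝ) := S ∩ φ ⁻¹' halfSpace u r with hS₁
  have hS₁m : MeasurableSet S₁ :=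
    hSm.inter ((isClosed_halfSpace u r).preimage hφc).measurableSet
  have hcover : S ⊆ S₁ ∪ (fun w => (2 : ℝ) • (WithLp.ofLp y) - w) ⁻¹' S₁ := by
    intro w hw
    by_cases h : φ w ∈ halfSpace u r
    · exact Or.inl ⟨hw, h⟩
    · refine Or.inr ⟨fun i _ => ?_, ?_⟩
      · have := hw i trivial
        simp only [mem_Icc, Pi.sub_apply, Pi.smul_apply, smul_eq_mul] at this ⊢
        constructor <;> linarith [this.1, this.2]
      · have hlin : φ ((2 : ℝ) • (WithLp.ofLp y) - w) = (2 : ℝ) • (o + columnMap a y) - φ w := by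
          have : WithLp.toLp 2 ((2 : ℝ) • (WithLp.ofLp y) - w) = (2 : ℝ) • y - WithLp.toLp 2 w := by
            simp
          simp only [hφ, this, map_sub, map_smul]
          module
        simp only [halfSpace, mem_preimage, mem_ofPred_eq, not_le] at h hx ⊢
        rw [hlin, inner_sub_right, inner_smul_right]
        linarith
  have hhalf : volume S ≤ 2 * volume S₁ := by
    refine (measure_mono hcover).trans ((measure_union_le _ _).trans_eq ?_)
    rw [(Measure.measurePreserving_sub_left volume ((2 : ℝ) • (WithLp.ofLp y))).measure_preimage
      hS₁m.nullMeasurableSet, two_mul]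
  have hincl : (fun y : Pt d => o + columnMap a y) '' (WithLp.ofLp ⁻¹' S₁) ⊆
      K ∩ halfSpace u r := by
    rintro _ ⟨w, ⟨hw, hwH⟩, rfl⟩
    have hwi : ∀ i, y i - y i / d ≤ w i ∧ w i ≤ y i + y i / d := fun i => hw i trivial
    refine ⟨hsub w (fun i => ?_) ?_, hwH⟩
    · have : y i / d ≤ y i := div_le_self (hy0 i) hd'
      linarith [(hwi i).1]
    · have h1 : ∑ i, w i ≤ ∑ i, (y i + (1 - ∑ j, y j) / d) :=
        Finset.sum_le_sum fun i _ => (hwi i).2.trans (by gcongr; exact hy1 i)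
      rw [Finset.sum_add_distrib, Finset.sum_const, Finset.card_univ, Fintype.card_fin,
        nsmul_eq_mul, mul_div_cancel₀ _ (by positivity)] at h1
      linarith
  have h2 := measure_mono (μ := volume) hincl
  rw [volume_image_columnMap o a S₁ hS₁m] at h2
  have h3 : ENNReal.ofReal D * volume S ≤ 2 * volume (K ∩ halfSpace u r) := by
    calc ENNReal.ofReal D * volume S ≤ ENNReal.ofReal D * (2 * volume S₁) := by gcongr
      _ = 2 * (ENNReal.ofReal D * volume S₁) := by ring
      _ ≤ _ := by gcongr
  rw [hSv, ← ENNReal.ofReal_mul (abs_nonneg _)] at h3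
  have h4 := ENNReal.toReal_mono (ENNReal.mul_ne_top (by simp) (volume_inter_ne_top hK _)) h3
  have hprod : 0 ≤ ∏ i, y i := Finset.prod_nonneg fun i _ => hy0 i
  rw [ENNReal.toReal_ofReal (by positivity), ENNReal.toReal_mul, ENNReal.toReal_ofNat,
    ← measureReal_def] at h4
  have h5 : (2 / d : ℝ) ^ d = 2 * (2 ^ (d - 1) / d ^ d) := by
    rw [div_pow, mul_div_assoc', ← pow_succ', Nat.sub_add_cancel hd]
  rw [h5] at h4
  linarith

lemma abs_det_columnMap_le (hd : 0 < d) {K : Set (Pt d)} (hV : volume K ≤ 1) {o : Pt d}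
    {a : Fin d → Pt d}
    (hsub : ∀ y : Pt d, (∀ i, 0 ≤ y i) → ∑ i, y i ≤ 1 → o + columnMap a y ∈ K) :
    |LinearMap.det (columnMap a)| ≤ d ^ d := by
  have hd' : (0 : ℝ) < d := by exact_mod_cast hd
  set S : Set (Fin d → ℝ) := univ.pi fun _ => Icc 0 (1 / d : ℝ) with hS
  have hSv : volume S = ENNReal.ofReal ((1 / d) ^ d) := by
    rw [hS, volume_pi_pi]
    rw [Finset.prod_const, Finset.card_univ, Fintype.card_fin, Real.volume_Icc, sub_zero,
      ENNReal.ofReal_pow (by positivity)]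
  have hincl : (fun y : Pt d => o + columnMap a y) '' (WithLp.ofLp ⁻¹' S) ⊆ K := by
    rintro _ ⟨w, hw, rfl⟩
    refine hsub w (fun i => (hw i trivial).1) ?_
    have h1 : ∑ i, w i ≤ ∑ _i : Fin d, (1 / d : ℝ) := Finset.sum_le_sum fun i _ => (hw i trivial).2
    simpa [hd'.ne'] using h1
  have h2 := (measure_mono (μ := volume) hincl).trans hV
  rw [volume_image_columnMap o a S (MeasurableSet.univ_pi fun i => measurableSet_Icc), hSv,
    ← ENNReal.ofReal_mul (abs_nonneg _), ENNReal.ofReal_le_one, one_div, inv_pow,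
    mul_inv_le_iff₀ (by positivity), one_mul] at h2
  exact h2

lemma exists_weights_of_mem_convexHull_range (g : Fin (d + 1) → Pt d) {x : Pt d}
    (hx : x ∈ convexHull ℝ (range g)) :
    ∃ c : Fin (d + 1) → ℝ, ((∀ i, 0 ≤ c i) ∧ ∑ i, c i = 1) ∧ ∑ i, c i • g i = x := by
  refine convexHull_min (t := {x | ∃ c : Fin (d + 1) → ℝ,
    ((∀ i, 0 ≤ c i) ∧ ∑ i, c i = 1) ∧ ∑ i, c i • g i = x}) ?_ ?_ hx
  · rintro _ ⟨i, rfl⟩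
    refine ⟨Pi.single i 1, ⟨fun j => ?_, by simp⟩, ?_⟩
    · by_cases h : j = i
      · subst h; simp
      · simp [h]
    · simp [Pi.single_apply]
  · rintro _ ⟨c, ⟨hc0, hc1⟩, rfl⟩ _ ⟨c', ⟨hc0', hc1'⟩, rfl⟩ a b ha hb hab
    refine ⟨fun i => a * c i + b * c' i, ⟨fun i => ?_, ?_⟩, ?_⟩
    · have := hc0 i; have := hc0' i; positivity
    · rw [Finset.sum_add_distrib, ← Finset.mul_sum, ← Finset.mul_sum, hc1, hc1', mul_one, mul_one,
        hab]
    · simp only [add_smul, Finset.sum_add_distrib, Finset.smul_sum, smul_smul]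

lemma mem_image_columnMap_of_mem_convexHull (g : Fin (d + 1) → Pt d) {x : Pt d}
    (hx : x ∈ convexHull ℝ (range g)) :
    ∃ (k : Fin (d + 1)) (y : Pt d), (∀ i, 0 ≤ y i) ∧ (∀ i, y i ≤ 1 - ∑ j, y j) ∧
      x = g k + columnMap (fun i => g (k.succAbove i) - g k) y := by
  obtain ⟨c, ⟨hc0, hc1⟩, rfl⟩ := exists_weights_of_mem_convexHull_range g hx
  obtain ⟨k, hk⟩ := Finite.exists_max c
  have hsum := Fin.sum_univ_succAbove c k
  rw [hc1] at hsum
  refine ⟨k, WithLp.toLp 2 fun i => c (k.succAbove i), fun i => hc0 _, fun i => ?_, ?_⟩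
  · simp only
    linarith [hk (k.succAbove i)]
  · rw [columnMap_apply, Fin.sum_univ_succAbove _ k]
    simp only [smul_sub, Finset.sum_sub_distrib, ← Finset.sum_smul]
    have : c k = 1 - ∑ i, c (k.succAbove i) := by linarith
    rw [this, sub_smul, one_smul]
    abel

lemma columnMap_mem_convexHull (g : Fin (d + 1) → Pt d) (k : Fin (d + 1)) {y : Pt d}
    (hy0 : ∀ i, 0 ≤ y i) (hy1 : ∑ i, y i ≤ 1) :
    g k + columnMap (fun i => g (k.succAbove i) - g k) y ∈ convexHull ℝ (range g) := by
  have h : g k + columnMap (fun i => g (k.succAbove i) - g k) y =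
      (1 - ∑ i, y i) • g k + ∑ i, y i • g (k.succAbove i) := by
    rw [columnMap_apply]
    simp only [smul_sub, Finset.sum_sub_distrib, ← Finset.sum_smul, sub_smul, one_smul]
    abel
  have h2 : (1 - ∑ i, y i) • g k + ∑ i, y i • g (k.succAbove i) =
      ∑ j, (k.insertNth (1 - ∑ i, y i) (fun i => y i) : Fin (d + 1) → ℝ) j • g j := by
    rw [Fin.sum_univ_succAbove _ k]
    simp
  rw [h, h2]
  refine (convex_convexHull ℝ _).sum_mem (fun j _ => ?_) ?_
    fun j _ => subset_convexHull ℝ _ ⟨j, rfl⟩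
  · refine k.succAboveCases ?_ (fun i => ?_) j
    · simpa using hy1
    · simpa using hy0 i
  · rw [Fin.sum_univ_succAbove _ k]
    simp

/-- The wet part occupies little volume in each simplex contained in the body. -/
lemma volume_wetPart_inter_simplex_le (hd : 0 < d) {K : Set (Pt d)} (hK : IsCompact K)
    (hc : Convex ℝ K) (hV : volume K ≤ 1) (g : Fin (d + 1) → Pt d) (hg : ∀ i, g i ∈ K) {t : ℝ}
    (ht : 0 < t) (htd : t ≤ Real.exp (-d)) :
    volume (wetPart K t ∩ convexHull ℝ (range g)) ≤
      (d + 1) * ENNReal.ofReal (Real.exp 1 * d ^ d * (t * (-Real.log t) ^ (d - 1))) := by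
  have hd' : (1 : ℝ) ≤ d := by exact_mod_cast hd
  have hlogt : (d : ℝ) ≤ -Real.log t := by
    have := Real.log_le_log ht htd
    rw [Real.log_exp] at this; linarith
  have hgK : convexHull ℝ (range g) ⊆ K := convexHull_min (by rintro _ ⟨i, rfl⟩; exact hg i) hc
  let f : Fin (d + 1) → Pt d →ₗ[ℝ] Pt d := fun k => columnMap fun i => g (k.succAbove i) - g k
  let D : Fin (d + 1) → ℝ := fun k => |LinearMap.det (f k)|
  let τ : Fin (d + 1) → ℝ := fun k => t * d ^ d / (2 ^ (d - 1) * D k)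
  have hcov : wetPart K t ∩ convexHull ℝ (range g) ⊆
      ⋃ k, (fun y : Pt d => g k + f k y) '' (WithLp.ofLp ⁻¹'
        {y | (∀ i, y i ∈ Icc (0 : ℝ) 1) ∧ D k * (2 ^ (d - 1) / d ^ d * ∏ i, y i) ≤ t}) := by
    rintro x ⟨hxw, hx⟩
    obtain ⟨k, y, hy0, hy1, rfl⟩ := mem_image_columnMap_of_mem_convexHull g hx
    refine mem_iUnion.2 ⟨k, y, ⟨fun i => ⟨hy0 i, ?_⟩, ?_⟩, rfl⟩
    · have := hy1 i
      have h0 : 0 ≤ ∑ j, y j := Finset.sum_nonneg fun j _ => hy0 j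
      linarith
    · refine (le_capVol_of_simplex hd hK (fun y h0 h1 => ?_) hy0 hy1).trans hxw.2
      exact hgK (columnMap_mem_convexHull g k h0 h1)
  refine (measure_mono hcov).trans ((measure_iUnion_le _).trans ?_)
  rw [tsum_fintype]
  refine (Finset.sum_le_card_nsmul _ _ (ENNReal.ofReal
    (Real.exp 1 * d ^ d * (t * (-Real.log t) ^ (d - 1)))) fun k _ => ?_).trans_eq (by simp)
  have hmeas : MeasurableSet {y : Fin d → ℝ | (∀ i, y i ∈ Icc (0 : ℝ) 1) ∧
      D k * (2 ^ (d - 1) / d ^ d * ∏ i, y i) ≤ t} := by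
    exact (isClosed_cube_inter_sublevel (by fun_prop) _).measurableSet
  rw [volume_image_columnMap _ _ _ hmeas]
  change ENNReal.ofReal (D k) * _ ≤ _
  have hDd : D k ≤ d ^ d := abs_det_columnMap_le hd hV (o := g k) fun y h0 h1 =>
    hgK (columnMap_mem_convexHull g k h0 h1)
  rcases (show 0 ≤ D k from abs_nonneg _).eq_or_lt with h0 | hpos
  · rw [← h0]; simp
  · have hτ : 0 < τ k := by positivity
    have hset : {y : Fin d → ℝ | (∀ i, y i ∈ Icc (0 : ℝ) 1) ∧
        D k * (2 ^ (d - 1) / d ^ d * ∏ i, y i) ≤ t} = hyperbolicCube d (τ k) := by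
      ext y
      refine and_congr_right fun _ => ?_
      simp only [τ]
      rw [le_div_iff₀ (by positivity), show D k * (2 ^ (d - 1) / d ^ d * ∏ i, y i) =
        ((∏ i, y i) * (2 ^ (d - 1) * D k)) / d ^ d by ring, div_le_iff₀ (by positivity)]
    rw [hset]
    refine (mul_le_mul_right (volume_hyperbolicCube_le hd hτ) _).trans ?_
    rw [← ENNReal.ofReal_mul hpos.le]
    refine ENNReal.ofReal_le_ofReal ?_
    have hlog : max 1 (-Real.log (τ k)) ≤ 2 * -Real.log t := by
      refine max_le (by linarith) ?_
      have h1 : t * (2 ^ (d - 1))⁻¹ ≤ τ k := by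
        simp only [τ]
        rw [← div_eq_mul_inv, div_le_div_iff₀ (by positivity) (by positivity)]
        have : t * 2 ^ (d - 1) * D k ≤ t * 2 ^ (d - 1) * d ^ d := by gcongr
        linarith
      have h2 := Real.log_le_log (by positivity) h1
      rw [Real.log_mul ht.ne' (by positivity), Real.log_inv, Real.log_pow] at h2
      have h3 : ((d - 1 : ℕ) : ℝ) * Real.log 2 ≤ d := by
        rw [Nat.cast_sub hd, Nat.cast_one]
        have := Real.log_two_lt_d9
        have := Real.log_two_gt_d9
        nlinarith
      linarith
    have h4 : max 1 (-Real.log (τ k)) ^ (d - 1) ≤ (2 * -Real.log t) ^ (d - 1) := by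
      gcongr
    calc D k * (Real.exp 1 * τ k * max 1 (-Real.log (τ k)) ^ (d - 1))
        ≤ D k * (Real.exp 1 * τ k * (2 * -Real.log t) ^ (d - 1)) := by gcongr
      _ = Real.exp 1 * d ^ d * (t * (-Real.log t) ^ (d - 1)) := by
          simp only [τ]
          rw [mul_pow]
          field_simp

lemma interior_nonempty_of_volume {K : Set (Pt d)} (hc : Convex ℝ K) (hV : volume K ≠ 0) :
    (interior K).Nonempty := by
  by_contra h
  rw [not_nonempty_iff_eq_empty] at h
  refine hV (measure_mono_null ?_ (hc.addHaar_frontier volume))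
  rw [frontier, h, sdiff_empty]
  exact subset_closure

lemma finrank_vectorSpan_of_interior {K : Set (Pt d)} (hi : (interior K).Nonempty) :
    Module.finrank ℝ (vectorSpan ℝ K) = d := by
  rw [← direction_affineSpan, affineSpan_eq_top_of_nonempty_interior
    (hi.mono (interior_mono (subset_convexHull ℝ K))), AffineSubspace.direction_top, finrank_top,
    finrank_euclideanSpace_fin]

/-- The wet part of a polytope of volume `1` has volume at most a constant, depending on `d` only,
times `F(P) t log (1 / t) ^ (d - 1)`. -/
lemma volume_wetPart_le (hd : 0 < d) {P : Set (Pt d)} (hP : IsPolytope P) (hV : volume P = 1)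
    {t : ℝ} (ht : 0 < t) (htd : t ≤ Real.exp (-d)) :
    volume.real (wetPart P t) ≤
      (d + 1) * (Real.exp 1 * d ^ d) * (flagCount P * (t * (-Real.log t) ^ (d - 1))) := by
  obtain ⟨V₀, hV₀, rfl⟩ := hP
  lift V₀ to Finset (Pt d) using hV₀ with V
  set P := convexHull ℝ (V : Set (Pt d)) with hP
  have hK : IsCompact P := V.finite_toSet.isCompact_convexHull ℝ
  have hc : Convex ℝ P := convex_convexHull ℝ _
  have hi := interior_nonempty_of_volume hc (by rw [hV]; exact one_ne_zero)
  have hne : V.Nonempty := by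
    have := hi.mono interior_subset
    rw [hP, convexHull_nonempty_iff] at this
    exact_mod_cast this
  have hfin := finite_flags V
  have hlogt : 0 ≤ -Real.log t := by
    have := Real.log_le_log ht htd
    rw [Real.log_exp] at this
    have : (0 : ℝ) ≤ d := by positivity
    linarith
  set b : ℝ := Real.exp 1 * d ^ d * (t * (-Real.log t) ^ (d - 1)) with hb
  have hb0 : 0 ≤ b := by positivity
  have hcov : wetPart P t ⊆ ⋃ F ∈ hfin.toFinset,
      wetPart P t ∩ convexHull ℝ (range (flagVertex V F)) := by
    intro x hx
    obtain ⟨F, hF, hxF⟩ := exists_flag_mem_convexHull V (finrank_vectorSpan_of_interior hi) hx.1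
    exact mem_iUnion₂.2 ⟨F, hfin.mem_toFinset.2 hF, hx, hxF⟩
  have h1 : volume (wetPart P t) ≤ flagCount P * ((d + 1) * ENNReal.ofReal b) := by
    refine (measure_mono hcov).trans ((measure_biUnion_finset_le _ _).trans ?_)
    refine (Finset.sum_le_card_nsmul _ _ ((d + 1) * ENNReal.ofReal b) fun F hF => ?_).trans_eq ?_
    · exact volume_wetPart_inter_simplex_le hd hK hc hV.le _
        (flagVertex_mem V hne (hfin.mem_toFinset.1 hF)) ht htd
    · rw [nsmul_eq_mul, flagCount, ncard_eq_toFinset_card _ hfin]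
  have h2 := ENNReal.toReal_mono (by finiteness) h1
  rw [ENNReal.toReal_mul, ENNReal.toReal_mul, ENNReal.toReal_ofReal hb0, ENNReal.toReal_natCast,
    ENNReal.toReal_add (by simp) (by simp), ENNReal.toReal_natCast, ENNReal.toReal_one,
    ← measureReal_def] at h2
  refine h2.trans_eq ?_
  rw [hb]; ring

end WetPart

/-! ### Poisson counts -/

section Poisson

lemma lintegral_exp_poissonMeasure (r : ℝ≥0) :
    ∫⁻ n : ℕ, ENNReal.ofReal (Real.exp n) ∂(poissonMeasure r) =
      ENNReal.ofReal (Real.exp (r * (Real.exp 1 - 1))) := by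
  have h := NormedSpace.expSeries_div_hasSum_exp ((r : ℝ) * Real.exp 1)
  rw [← Real.exp_eq_exp_ℝ] at h
  have h2 := h.mul_left (Real.exp (-r))
  rw [← Real.exp_add, show -(r : ℝ) + r * Real.exp 1 = r * (Real.exp 1 - 1) by ring] at h2
  rw [poissonMeasure, lintegral_sum_measure, ← h2.tsum_eq,
    ENNReal.ofReal_tsum_of_nonneg (fun n => by positivity) h2.summable]
  refine tsum_congr fun n => ?_
  rw [lintegral_smul_measure, lintegral_dirac, smul_eq_mul, ← ENNReal.ofReal_mul (by positivity)]
  congr 1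
  rw [mul_pow, ← Real.exp_one_pow]
  ring

/-- Chernoff bound for the upper tail of a Poisson variable of mean at most `L`. -/
lemma poissonMeasure_tail_le {r : ℝ≥0} {L : ℝ} (hr : (r : ℝ) ≤ L) :
    poissonMeasure r {n : ℕ | 3 * L < n} ≤ ENNReal.ofReal (Real.exp (-L)) := by
  have h1 := mul_meas_ge_le_lintegral (μ := poissonMeasure r)
    (f := fun n : ℕ => ENNReal.ofReal (Real.exp n)) (by fun_prop)
    (ENNReal.ofReal (Real.exp (3 * L)))
  rw [lintegral_exp_poissonMeasure] at h1
  have h2 : {n : ℕ | 3 * L < n} ⊆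
      {n : ℕ | ENNReal.ofReal (Real.exp (3 * L)) ≤ ENNReal.ofReal (Real.exp n)} := fun n hn =>
    ENNReal.ofReal_le_ofReal (Real.exp_le_exp.2 (le_of_lt hn))
  have h3 : ENNReal.ofReal (Real.exp (3 * L)) * poissonMeasure r {n : ℕ | 3 * L < n} ≤
      ENNReal.ofReal (Real.exp (3 * L)) * ENNReal.ofReal (Real.exp (-L)) := by
    refine (mul_le_mul_right (measure_mono h2) _).trans (h1.trans ?_)
    rw [← ENNReal.ofReal_mul (Real.exp_pos _).le, ← Real.exp_add]
    refine ENNReal.ofReal_le_ofReal (Real.exp_le_exp.2 ?_)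
    have he : Real.exp 1 < 3 := by linarith [Real.exp_one_lt_d9]
    have he' : 1 < Real.exp 1 := Real.one_lt_exp_iff.2 one_pos
    have hr0 : (0 : ℝ) ≤ r := r.2
    nlinarith
  exact (ENNReal.mul_le_mul_iff_right (by simp [Real.exp_pos]) ENNReal.ofReal_ne_top).1 h3

variable {d : ℕ} {Ω : Type*} [MeasurableSpace Ω] {μ : Measure Ω} {η : ℝ} {X : Ω → Set (Pt d)}

lemma IsPoissonProcess.measure_count (hX : IsPoissonProcess μ η X) {B : Set (Pt d)}
    (hB : MeasurableSet B) (hB' : volume B ≠ ∞) (E : Set ℕ∞) :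
    μ {ω | (X ω ∩ B).encard ∈ E} =
      poissonMeasure (Real.toNNReal (η * volume.real B)) {n : ℕ | (n : ℕ∞) ∈ E} := by
  have hE : MeasurableSet E := MeasurableSet.of_discrete
  have h := congrArg (fun ν => ν E) (hX.law_count B hB hB')
  rwa [Measure.map_apply (hX.measurable_count B hB) hE,
    Measure.map_apply Measurable.of_discrete hE] at h

lemma IsPoissonProcess.measure_inter_eq_empty (hX : IsPoissonProcess μ η X) (hη : 0 ≤ η)
    {B : Set (Pt d)} (hB : MeasurableSet B) (hB' : volume B ≠ ∞) :
    μ.real {ω | X ω ∩ B = ∅} = Real.exp (-(η * volume.real B)) := by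
  have h := hX.measure_count hB hB' {0}
  have h0 : {n : ℕ | (n : ℕ∞) ∈ ({0} : Set ℕ∞)} = {0} := by ext n; simp
  rw [h0, poissonMeasure_singleton] at h
  have h1 : {ω | (X ω ∩ B).encard ∈ ({0} : Set ℕ∞)} = {ω | X ω ∩ B = ∅} := by ext; simp
  rw [h1] at h
  rw [measureReal_def, h, ENNReal.toReal_ofReal (by positivity),
    Real.coe_toNNReal _ (mul_nonneg hη measureReal_nonneg)]
  simp

lemma IsPoissonProcess.measure_inter_nonempty [IsProbabilityMeasure μ]
    (hX : IsPoissonProcess μ η X) (hη : 0 ≤ η)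
    {B : Set (Pt d)} (hB : MeasurableSet B) (hB' : volume B ≠ ∞) :
    μ.real {ω | (X ω ∩ B).Nonempty} = 1 - Real.exp (-(η * volume.real B)) := by
  have hm : MeasurableSet {ω | X ω ∩ B = ∅} := by
    have : {ω | X ω ∩ B = ∅} = (fun ω => (X ω ∩ B).encard) ⁻¹' {0} := by ext; simp
    rw [this]; exact hX.measurable_count B hB MeasurableSet.of_discrete
  have h1 : {ω | (X ω ∩ B).Nonempty} = {ω | X ω ∩ B = ∅}ᶜ := by
    ext ω; simp [nonempty_iff_ne_empty]
  rw [h1, probReal_compl_eq_one_sub hm, hX.measure_inter_eq_empty hη hB hB']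

lemma IsPoissonProcess.measure_count_gt_le [IsProbabilityMeasure μ]
    (hX : IsPoissonProcess μ η X) {B : Set (Pt d)} (hB : MeasurableSet B) (hB' : volume B ≠ ∞)
    {L : ℝ} (hL : 0 ≤ L) (hle : η * volume.real B ≤ L) :
    μ.real {ω | ¬ ((X ω ∩ B).Finite ∧ ((X ω ∩ B).ncard : ℝ) ≤ 3 * L)} ≤ Real.exp (-L) := by
  have h := hX.measure_count hB hB' {k | ∀ n : ℕ, k = n → 3 * L < n}
  have h0 : {n : ℕ | (n : ℕ∞) ∈ {k : ℕ∞ | ∀ n : ℕ, k = n → 3 * L < n}} =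
      {n : ℕ | 3 * L < n} := by
    ext n
    simp only [mem_ofPred_eq, Nat.cast_inj]
    exact ⟨fun h => h n rfl, fun h m hm => hm ▸ h⟩
  rw [h0] at h
  have hsub : {ω | ¬ ((X ω ∩ B).Finite ∧ ((X ω ∩ B).ncard : ℝ) ≤ 3 * L)} ⊆
      {ω | (X ω ∩ B).encard ∈ {k : ℕ∞ | ∀ n : ℕ, k = n → 3 * L < n}} := by
    intro ω hω n hn
    by_contra hle'
    refine hω ⟨finite_of_encard_eq_coe hn, ?_⟩
    rw [ncard_def, hn, ENat.toNat_natCast]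
    exact not_lt.1 hle'
  refine (measureReal_mono hsub).trans ?_
  rw [measureReal_def, h]
  refine ENNReal.toReal_le_of_le_ofReal (Real.exp_pos _).le (poissonMeasure_tail_le ?_)
  rw [Real.coe_toNNReal']
  exact max_le hle hL

end Poisson

/-! ### The number of points in a saturated system -/

section Counting

variable {d : ℕ} {K : Set (Pt d)}

lemma isCompact_macbeath (hK : IsCompact K) (z : Pt d) (lam : ℝ) :
    IsCompact (macbeath K z lam) := by
  have h1 : IsCompact {w : Pt d | z + w ∈ K} :=
    (Homeomorph.addLeft z).isClosedEmbedding.isCompact_preimage hK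
  have h2 : IsClosed {w : Pt d | z - w ∈ K} := hK.isClosed.preimage (by fun_prop)
  exact (h1.inter_right h2).image (by fun_prop)

lemma isClosed_cap (hK : IsCompact K) (u : Pt d) (t : ℝ) : IsClosed (cap K u t) :=
  hK.isClosed.inter (isClosed_halfSpace _ _)

lemma SaturatedSystem.measurableSet_half (hK : IsCompact K) {T : ℝ} (Y : SaturatedSystem K T)
    (j : Fin Y.m) : MeasurableSet (Y.half j) :=
  (isCompact_macbeath hK _ _).measurableSet.inter (isClosed_cap hK _ _).measurableSet

lemma SaturatedSystem.half_subset_cap {T : ℝ} (Y : SaturatedSystem K T) (j : Fin Y.m) :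
    Y.half j ⊆ cap K (Y.dir j) (Y.depth j) := inter_subset_right

lemma SaturatedSystem.capVol_eq (hd : 0 < d) (hK : IsCompact K) (hc : Convex ℝ K) {T : ℝ}
    (hT : 0 < T) (Y : SaturatedSystem K T) (j : Fin Y.m) : capVol K (Y.y j) = T :=
  (capVol_eq_of_mem_floatingBoundary hd hK hc hT (Y.mem_boundary j)).2

lemma SaturatedSystem.volume_cap_eq (hd : 0 < d) (hK : IsCompact K) (hc : Convex ℝ K) {T : ℝ}
    (hT : 0 < T) (Y : SaturatedSystem K T) (j : Fin Y.m) :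
    volume.real (cap K (Y.dir j) (Y.depth j)) = T :=
  (Y.minimalCap j).2.2.trans (Y.capVol_eq hd hK hc hT j)

lemma SaturatedSystem.le_volume_half (hd : 0 < d) (hK : IsCompact K) (hc : Convex ℝ K)
    (hi : (interior K).Nonempty) {T : ℝ} (hT : 0 < T) (Y : SaturatedSystem K T) (j : Fin Y.m) :
    ((6 * d : ℝ) ^ d)⁻¹ * T ≤ volume.real (Y.half j) := by
  have h := Y.capVol_eq hd hK hc hT j
  have := le_volume_half_macbeath hd hK hc hi (Y.minimalCap j) (by rw [h]; exact hT)
  rwa [h] at this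

lemma cap_subset_wetPart {u : Pt d} (hu : u ≠ 0) {t T : ℝ}
    (h : volume.real (cap K u t) ≤ T) : cap K u t ⊆ wetPart K T := fun _ hz =>
  ⟨hz.1, (capVol_le hu hz.2).trans h⟩

/-- The half Macbeath regions of a saturated system on `K(v = T)` are disjoint parts of the wet
part `K(v ≤ T)` of volume at least `T / (6 d) ^ d`; this bounds their number. -/
lemma SaturatedSystem.card_mul_le (hd : 0 < d) (hK : IsCompact K) (hc : Convex ℝ K)
    (hi : (interior K).Nonempty) {T : ℝ} (hT : 0 < T) (Y : SaturatedSystem K T) :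
    Y.m * (((6 * d : ℝ) ^ d)⁻¹ * T) ≤ volume.real (wetPart K T) := by
  have hne : ∀ S : Set (Pt d), S ⊆ K → volume S ≠ ∞ := fun S hS =>
    ((measure_mono hS).trans_lt hK.measure_lt_top).ne
  have hsub : (⋃ j, Y.half j) ⊆ wetPart K T := iUnion_subset fun j =>
    (Y.half_subset_cap j).trans (cap_subset_wetPart
      (by intro h0; have := (Y.minimalCap j).1; simp [h0] at this)
      (Y.volume_cap_eq hd hK hc hT j).le)
  calc Y.m * (((6 * d : ℝ) ^ d)⁻¹ * T) = ∑ _j : Fin Y.m, (((6 * d : ℝ) ^ d)⁻¹ * T) := by simp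
    _ ≤ ∑ j, volume.real (Y.half j) :=
        Finset.sum_le_sum fun j _ => Y.le_volume_half hd hK hc hi hT j
    _ = volume.real (⋃ j, Y.half j) := by
        rw [measureReal_iUnion_fintype (fun i j hij => ?_) (fun j => Y.measurableSet_half hK j)
          (fun j => hne _ ((Y.half_subset_cap j).trans inter_subset_left))]
        exact (Y.disjoint i j hij).mono inter_subset_left inter_subset_left
    _ ≤ volume.real (wetPart K T) := measureReal_mono hsub (hne _ fun _ hx => hx.1)

/-- There are caps of any given volume. -/
lemma exists_volume_halfSpace_eq (hd : 0 < d) (hK : IsCompact K) {s : ℝ} (hs0 : 0 ≤ s)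
    (hs : s ≤ volume.real K) :
    ∃ (u : Pt d) (a : ℝ), u ≠ 0 ∧ volume.real (K ∩ halfSpace u a) = s := by
  obtain ⟨u, hu⟩ := exists_unit hd
  have hu0 : u ≠ 0 := by rintro rfl; simp at hu
  obtain ⟨R, hR⟩ := (hK.image (by fun_prop : Continuous fun x => ⟪u, x⟫)).isBounded.bddBelow
  have h := mem_range_of_exists_le_of_exists_ge (c := s) (continuous_volume_halfSpace hK hu0)
    ⟨supportFn K u + 1, ?_⟩ ⟨R, ?_⟩
  · obtain ⟨a, ha⟩ := h; exact ⟨u, a, hu0, ha⟩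
  · have : K ∩ halfSpace u (supportFn K u + 1) = ∅ := by
      ext y
      simp only [mem_inter_iff, halfSpace, mem_ofPred_eq, mem_empty_iff_false, iff_false, not_and,
        not_le]
      intro hy
      linarith [inner_le_supportFn hK u hy]
    simpa [this] using hs0
  · have : K ∩ halfSpace u R = K := inter_eq_left.2 fun x hx => hR ⟨x, hx, rfl⟩
    rwa [this]

end Counting

/-! ### The size of the parameters -/

section Parameters

variable {d : ℕ}

/-- The exponent `β = 4 d² + d - 1`, as a natural number. -/
def betaExp (d : ℕ) : ℕ := 4 * d ^ 2 + (d - 1)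

lemma cast_betaExp (hd : 0 < d) : (betaExp d : ℝ) = 4 * (d : ℝ) ^ 2 + d - 1 := by
  rw [betaExp, Nat.cast_add, Nat.cast_sub hd]
  push_cast; ring

lemma alpha_eq (hd : 0 < d) : alpha d = (6 * d) ^ d * betaExp d := by
  rw [alpha, cast_betaExp hd]

lemma one_le_betaExp (hd : 0 < d) : (1 : ℝ) ≤ betaExp d := by
  have : 1 ≤ betaExp d := by
    have : 1 ≤ d ^ 2 := Nat.one_le_pow _ _ hd
    rw [betaExp]; omega
  exact_mod_cast this

lemma betaExp_le_alpha (hd : 0 < d) : (betaExp d : ℝ) ≤ alpha d := by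
  have hd' : (1 : ℝ) ≤ d := by exact_mod_cast hd
  rw [alpha_eq hd]
  exact le_mul_of_one_le_left (by positivity) (one_le_pow₀ (by linarith))

lemma one_le_gam (hd : 0 < d) : 1 ≤ gam d := by
  have hd' : (1 : ℝ) ≤ d := by exact_mod_cast hd
  have h1 : (1 : ℝ) ≤ d ^ 3 := one_le_pow₀ hd'
  have h2 : (1 : ℝ) ≤ 6 ^ d := one_le_pow₀ (by norm_num)
  rw [gam]
  nlinarith

lemma betaExp_le (hd : 0 < d) : betaExp d ≤ (3 * d) ^ (d + 2) := by
  have h2 : d ≤ d ^ 2 := Nat.le_self_pow two_ne_zero d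
  calc betaExp d ≤ (3 * d) ^ 2 := by
        rw [betaExp, mul_pow]; omega
    _ ≤ (3 * d) ^ (d + 2) := Nat.pow_le_pow_right (by omega) (by omega)

lemma exp_neg_mul_log {x : ℝ} (hx : 0 < x) (n : ℕ) :
    Real.exp (-(n * Real.log x)) = (x ^ n)⁻¹ := by
  rw [Real.exp_neg, mul_comm, Real.exp_mul, Real.exp_log hx, Real.rpow_natCast]

lemma paramS_eq (hd : 0 < d) (η : ℝ) : paramS d η = 1 / (η * Real.log η ^ betaExp d) := by
  rw [paramS, ← cast_betaExp hd, Real.rpow_natCast]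

/-- The intensity `η` is large enough, in terms of `d`: then `1 / η ≤ T`, the volumes `T` and `s`
are small enough for the estimates of the wet part and for Helly's theorem, and `log (1 / T)` and
`log (1 / s)` are at most `2 log η`. -/
structure IsLarge (d : ℕ) (η : ℝ) : Prop where
  pos : 0 < η
  one_le_loglog : 1 ≤ Real.log (Real.log η)
  one_le_log : 1 ≤ Real.log η
  paramT_le : paramT d η ≤ Real.exp (-d)
  paramT_lt : (d + 1) * paramT d η < 1
  beta_loglog_le : betaExp d * Real.log (Real.log η) ≤ Real.log η

lemma eventually_isLarge (d : ℕ) : ∀ᶠ η in Filter.atTop, IsLarge d η := by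
  have hlog := Real.tendsto_log_atTop
  have hll := hlog.comp hlog
  have ho : Filter.Tendsto (fun η => Real.log (Real.log η) / Real.log η) Filter.atTop (nhds 0) :=
    (Real.isLittleO_log_id_atTop.tendsto_div_nhds_zero).comp hlog
  have ho1 : Filter.Tendsto (fun η => Real.log η / η) Filter.atTop (nhds 0) :=
    Real.isLittleO_log_id_atTop.tendsto_div_nhds_zero
  have hT : Filter.Tendsto (paramT d) Filter.atTop (nhds 0) := by
    have h := (ho.mul ho1).const_mul (alpha d)
    rw [mul_zero, mul_zero] at h
    refine h.congr' ?_
    filter_upwards [hlog.eventually_gt_atTop 0] with η hη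
    rw [paramT]
    field_simp
  have hb := ho.const_mul (betaExp d : ℝ)
  rw [mul_zero] at hb
  have hT2 := hT.const_mul (d + 1 : ℝ)
  rw [mul_zero] at hT2
  filter_upwards [Filter.eventually_gt_atTop 0, hll.eventually_ge_atTop 1,
    hlog.eventually_ge_atTop 1, hT.eventually_le_const (Real.exp_pos (-d)),
    hT2.eventually_lt_const one_pos, hb.eventually_le_const one_pos] with η h1 h2 h3 h4 h5 h6
  refine ⟨h1, h2, h3, h4, h5, ?_⟩
  rw [← mul_div_assoc, div_le_one (by linarith)] at h6
  exact h6

namespace IsLarge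

variable {η : ℝ}

lemma inv_le_paramT (h : IsLarge d η) (hd : 0 < d) : 1 / η ≤ paramT d η := by
  rw [paramT]
  have h1 : 1 ≤ alpha d := (one_le_betaExp hd).trans (betaExp_le_alpha hd)
  have := h.pos
  gcongr
  nlinarith [h.one_le_loglog]

lemma paramT_pos (h : IsLarge d η) (hd : 0 < d) : 0 < paramT d η :=
  (one_div_pos.2 h.pos).trans_le (h.inv_le_paramT hd)

lemma neg_log_paramT_le (h : IsLarge d η) (hd : 0 < d) : -Real.log (paramT d η) ≤ Real.log η := by
  have := Real.log_le_log (one_div_pos.2 h.pos) (h.inv_le_paramT hd)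
  rw [one_div, Real.log_inv] at this
  linarith

lemma neg_log_paramT_nonneg (h : IsLarge d η) (hd : 0 < d) : 0 ≤ -Real.log (paramT d η) := by
  have := Real.log_le_log (h.paramT_pos hd) h.paramT_le
  rw [Real.log_exp] at this
  have : (0 : ℝ) ≤ d := by positivity
  linarith

lemma paramS_pos (h : IsLarge d η) (hd : 0 < d) : 0 < paramS d η := by
  rw [paramS_eq hd]
  have := h.pos
  have : 0 < Real.log η := by linarith [h.one_le_log]
  positivity

lemma paramS_le (h : IsLarge d η) (hd : 0 < d) : paramS d η ≤ Real.exp (-d) := by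
  refine le_trans ?_ ((h.inv_le_paramT hd).trans h.paramT_le)
  rw [paramS_eq hd]
  have := h.pos
  exact one_div_le_one_div_of_le this
    (le_mul_of_one_le_right this.le (one_le_pow₀ h.one_le_log))

lemma mul_paramS (h : IsLarge d η) (hd : 0 < d) :
    η * paramS d η = (Real.log η ^ betaExp d)⁻¹ := by
  rw [paramS_eq hd]
  have := h.pos
  have : 0 < Real.log η := by linarith [h.one_le_log]
  field_simp

lemma neg_log_paramS_le (h : IsLarge d η) (hd : 0 < d) :
    -Real.log (paramS d η) ≤ 2 * Real.log η := by
  have h1 := h.pos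
  have h2 : 0 < Real.log η := by linarith [h.one_le_log]
  rw [paramS_eq hd, one_div, Real.log_inv, Real.log_mul h1.ne' (by positivity), Real.log_pow]
  linarith [h.beta_loglog_le]

lemma neg_log_paramS_nonneg (h : IsLarge d η) (hd : 0 < d) : 0 ≤ -Real.log (paramS d η) := by
  have := Real.log_le_log (h.paramS_pos hd) (h.paramS_le hd)
  rw [Real.log_exp] at this
  have : (0 : ℝ) ≤ d := by positivity
  linarith

lemma log_pow_mul_inv (h : IsLarge d η) :
    Real.log η ^ (d - 1) * (Real.log η ^ betaExp d)⁻¹ = (Real.log η ^ (4 * d ^ 2))⁻¹ := by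
  have h2 : 0 < Real.log η := by linarith [h.one_le_log]
  rw [betaExp, pow_add]
  field_simp

end IsLarge

end Parameters

/-! ### The event `A` -/

section Event

variable {d : ℕ} {P : Set (Pt d)} {η : ℝ}

/-- The constant in the bound for the number of points in a saturated system. -/
def cardConst (d : ℕ) : ℝ := (6 * d) ^ d * ((d + 1) * (Real.exp 1 * d ^ d))

lemma SaturatedSystem.card_le (hd : 0 < d) (hP : IsPolytope P) (hV : volume P = 1)
    (hK : IsCompact P) (hc : Convex ℝ P) (hη : IsLarge d η)
    (Y : SaturatedSystem P (paramT d η)) :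
    (Y.m : ℝ) ≤ cardConst d * (flagCount P * Real.log η ^ (d - 1)) := by
  have hd' : (0 : ℝ) < d := by exact_mod_cast hd
  have hT := hη.paramT_pos hd
  have hi := interior_nonempty_of_volume hc (by rw [hV]; exact one_ne_zero)
  have h1 := (Y.card_mul_le hd hK hc hi hT).trans (volume_wetPart_le hd hP hV hT hη.paramT_le)
  have h2 : (-Real.log (paramT d η)) ^ (d - 1) ≤ Real.log η ^ (d - 1) :=
    pow_le_pow_left₀ (hη.neg_log_paramT_nonneg hd) (hη.neg_log_paramT_le hd) _
  have h3 : Y.m * (((6 * d : ℝ) ^ d)⁻¹ * paramT d η) ≤ (d + 1) * (Real.exp 1 * d ^ d) *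
      (flagCount P * (paramT d η * Real.log η ^ (d - 1))) := by
    refine h1.trans ?_
    gcongr
  have h4 : (Y.m : ℝ) * ((6 * d : ℝ) ^ d)⁻¹ ≤ (d + 1) * (Real.exp 1 * d ^ d) *
      (flagCount P * Real.log η ^ (d - 1)) := by
    refine le_of_mul_le_mul_right ?_ hT
    linarith
  rw [mul_inv_le_iff₀ (by positivity)] at h4
  rw [cardConst]
  linarith

/-- The bound on the mean number of points in an enlarged covering cap. -/
def capMean (d : ℕ) (η : ℝ) : ℝ := (6 * gam d) ^ d * alpha d * Real.log (Real.log η)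

lemma IsLarge.capMean_nonneg (hη : IsLarge d η) (hd : 0 < d) : 0 ≤ capMean d η := by
  have h1 := one_le_gam hd
  have h2 := (one_le_betaExp hd).trans (betaExp_le_alpha hd)
  have h3 := hη.one_le_loglog
  rw [capMean]
  positivity

lemma IsLarge.exp_neg_capMean_le (hη : IsLarge d η) (hd : 0 < d) :
    Real.exp (-capMean d η) ≤ (Real.log η ^ betaExp d)⁻¹ := by
  have h0 : 0 < Real.log η := by linarith [hη.one_le_log]
  rw [← exp_neg_mul_log h0]
  refine Real.exp_le_exp.2 (neg_le_neg ?_)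
  rw [capMean]
  have h1 : 1 ≤ (6 * gam d) ^ d := one_le_pow₀ (by linarith [one_le_gam hd])
  have h2 := betaExp_le_alpha hd
  have h3 := hη.one_le_loglog
  have h4 := one_le_betaExp hd
  gcongr
  nlinarith

lemma SaturatedSystem.mean_bigCap_le (hd : 0 < d) (hK : IsCompact P) (hc : Convex ℝ P)
    (hη : IsLarge d η) (Y : SaturatedSystem P (paramT d η)) (j : Fin Y.m) :
    η * volume.real (Y.bigCap (gam d) j) ≤ capMean d η := by
  have hT := hη.paramT_pos hd
  have h1 := volume_cap_mul_le hK hc ⟨_, (Y.minimalCap j).2.1.1⟩ (Y.dir j) (Y.depth j)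
    (lam := 6 * gam d) (by linarith [one_le_gam hd])
  rw [Y.volume_cap_eq hd hK hc hT j] at h1
  refine (mul_le_mul_of_nonneg_left h1 hη.pos.le).trans_eq ?_
  have := hη.pos
  rw [capMean, paramT]
  field_simp

lemma wetPart_inter_finite_and_card_le {Ω : Type*} {X : Ω → Set (Pt d)}
    (hd : 0 < d) (hP : IsPolytope P) (hV : volume P = 1) (hK : IsCompact P) (hc : Convex ℝ P) (hη : IsLarge d η)
    (Y : SaturatedSystem P (paramT d η)) (S : Fin Y.m → Set (Pt d)) (hS : IsDissection P η Y S)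
    {ω : Ω} (hω : ω ∈ eventA P η Y S X) :
    (wetPart P (paramTstar d η) ∩ X ω).Finite ∧
      ((wetPart P (paramTstar d η) ∩ X ω).ncard : ℝ) ≤
        3 * ((6 * gam d) ^ d * alpha d) * cardConst d *
          (flagCount P * (Real.log η ^ (d - 1) * Real.log (Real.log η))) := by
  obtain ⟨-, -, hA⟩ := hω
  have hcov : wetPart P (paramTstar d η) ∩ X ω =
      ⋃ j, X ω ∩ (S j ∩ wetPart P (paramTstar d η)) := by
    rw [← inter_iUnion, ← iUnion_inter, hS.union_eq, inter_comm]
    congr 1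
    exact (inter_eq_right.2 fun x hx => hx.1).symm
  refine ⟨hcov ▸ finite_iUnion fun j => (hA j).1, ?_⟩
  have hcard : (wetPart P (paramTstar d η) ∩ X ω).ncard ≤
      ∑ j, (X ω ∩ (S j ∩ wetPart P (paramTstar d η))).ncard := by
    rw [hcov]
    exact ncard_iUnion_le_of_fintype _
  have hL := hη.capMean_nonneg hd
  calc ((wetPart P (paramTstar d η) ∩ X ω).ncard : ℝ)
      ≤ ∑ j, ((X ω ∩ (S j ∩ wetPart P (paramTstar d η))).ncard : ℝ) := by exact_mod_cast hcard
    _ ≤ ∑ _j : Fin Y.m, 3 * capMean d η := Finset.sum_le_sum fun j _ =>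
        (hA j).2.trans_eq (by rw [capMean]; ring)
    _ = Y.m * (3 * capMean d η) := by simp
    _ ≤ cardConst d * (flagCount P * Real.log η ^ (d - 1)) * (3 * capMean d η) := by
        gcongr
        exact Y.card_le hd hP hV hK hc hη
    _ = _ := by rw [capMean]; ring

variable {Ω : Type*} [MeasurableSpace Ω] {μ : Measure Ω} {X : Ω → Set (Pt d)}

/-- The wet part `P(v ≤ s)` contains a cap of volume `s`, which `X` meets with probability
`1 - exp (-η s)`. -/
lemma le_measure_compl_eventA [IsProbabilityMeasure μ] (hd : 0 < d) (hV : volume P = 1)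
    (hK : IsCompact P) (hη : IsLarge d η) (Y : SaturatedSystem P (paramT d η))
    (S : Fin Y.m → Set (Pt d)) (hX : IsPoissonProcess μ η X) :
    1 / 2 * (Real.log η ^ ((3 * d) ^ (d + 2)))⁻¹ ≤ μ.real (eventA P η Y S X)ᶜ := by
  have hs := hη.paramS_pos hd
  have hs1 : paramS d η ≤ volume.real P := by
    rw [measureReal_def, hV, ENNReal.toReal_one]
    refine (hη.paramS_le hd).trans (Real.exp_le_one_iff.2 ?_)
    have : (0 : ℝ) ≤ d := by positivity
    linarith
  obtain ⟨u, a, hu, ha⟩ := exists_volume_halfSpace_eq hd hK hs.le hs1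
  have hsub : {ω | (X ω ∩ (P ∩ halfSpace u a)).Nonempty} ⊆ (eventA P η Y S X)ᶜ := by
    rintro ω ⟨x, hxX, hxP, hxH⟩ ⟨-, hA, -⟩
    have : x ∈ X ω ∩ wetPart P (paramS d η) := ⟨hxX, hxP, (capVol_le hu hxH).trans ha.le⟩
    rw [hA] at this
    exact this
  refine le_trans ?_ (measureReal_mono hsub)
  rw [hX.measure_inter_nonempty hη.pos.le
    (hK.isClosed.inter (isClosed_halfSpace u a)).measurableSet (volume_inter_ne_top hK _), ha,
    hη.mul_paramS hd]
  have hx1 := hη.one_le_log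
  have h1 : (Real.log η ^ ((3 * d) ^ (d + 2)))⁻¹ ≤ (Real.log η ^ betaExp d)⁻¹ := by
    have := betaExp_le hd
    gcongr
  set q := (Real.log η ^ betaExp d)⁻¹ with hq
  have hq0 : 0 < q := by positivity
  have hq1 : q ≤ 1 := inv_le_one_of_one_le₀ (one_le_pow₀ hx1)
  have h2 : Real.exp (-q) ≤ (1 + q)⁻¹ := by
    rw [Real.exp_neg]
    exact inv_anti₀ (by positivity) (by linarith [Real.add_one_le_exp q])
  have h3 : (1 + q)⁻¹ ≤ 1 - q / 2 := by
    rw [inv_le_iff_one_le_mul₀ (by positivity)]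
    nlinarith
  linarith

lemma measure_half_empty_le (hd : 0 < d) (hV : volume P = 1) (hK : IsCompact P)
    (hc : Convex ℝ P) (hη : IsLarge d η) (Y : SaturatedSystem P (paramT d η))
    (hX : IsPoissonProcess μ η X) (j : Fin Y.m) :
    μ.real {ω | X ω ∩ Y.half j = ∅} ≤ (Real.log η ^ betaExp d)⁻¹ := by
  have hd' : (0 : ℝ) < d := by exact_mod_cast hd
  have hi := interior_nonempty_of_volume hc (by rw [hV]; exact one_ne_zero)
  rw [hX.measure_inter_eq_empty hη.pos.le (Y.measurableSet_half hK j)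
    ((measure_mono ((Y.half_subset_cap j).trans inter_subset_left)).trans_lt hK.measure_lt_top).ne,
    ← exp_neg_mul_log (by linarith [hη.one_le_log])]
  refine Real.exp_le_exp.2 (neg_le_neg ?_)
  have h1 := mul_le_mul_of_nonneg_left
    (Y.le_volume_half hd hK hc hi (hη.paramT_pos hd) j) hη.pos.le
  refine le_trans (le_of_eq ?_) h1
  have := hη.pos
  rw [paramT, alpha_eq hd]
  field_simp

lemma measure_wetPart_nonempty_le [IsProbabilityMeasure μ] (hd : 0 < d) (hP : IsPolytope P) (hV : volume P = 1)
    (hK : IsCompact P) (hη : IsLarge d η) (hX : IsPoissonProcess μ η X) :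
    μ.real {ω | (X ω ∩ wetPart P (paramS d η)).Nonempty} ≤
      (d + 1) * (Real.exp 1 * d ^ d) * 2 ^ (d - 1) *
        (flagCount P * (Real.log η ^ (4 * d ^ 2))⁻¹) := by
  have hη0 := hη.pos
  rw [hX.measure_inter_nonempty hη0.le (isClosed_wetPart hd hK _).measurableSet
    ((measure_mono fun x hx => hx.1).trans_lt hK.measure_lt_top).ne]
  have h1 := Real.add_one_le_exp (-(η * volume.real (wetPart P (paramS d η))))
  have h2 := volume_wetPart_le hd hP hV (hη.paramS_pos hd) (hη.paramS_le hd)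
  have h3 : (-Real.log (paramS d η)) ^ (d - 1) ≤ (2 * Real.log η) ^ (d - 1) :=
    pow_le_pow_left₀ (hη.neg_log_paramS_nonneg hd) (hη.neg_log_paramS_le hd) _
  have hs := hη.paramS_pos hd
  calc 1 - Real.exp (-(η * volume.real (wetPart P (paramS d η))))
      ≤ η * volume.real (wetPart P (paramS d η)) := by linarith
    _ ≤ η * ((d + 1) * (Real.exp 1 * d ^ d) *
          (flagCount P * (paramS d η * (2 * Real.log η) ^ (d - 1)))) := by
        refine mul_le_mul_of_nonneg_left (h2.trans ?_) hη0.le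
        gcongr
    _ = (d + 1) * (Real.exp 1 * d ^ d) * 2 ^ (d - 1) *
          (flagCount P * (Real.log η ^ (d - 1) * (η * paramS d η))) := by
        rw [mul_pow]; ring
    _ = _ := by rw [hη.mul_paramS hd, hη.log_pow_mul_inv]

/-- Union bound over the ways in which `A` can fail. -/
lemma measure_compl_eventA_le [IsProbabilityMeasure μ] (hd : 0 < d) (hP : IsPolytope P) (hV : volume P = 1)
    (hK : IsCompact P) (hc : Convex ℝ P) (hη : IsLarge d η)
    (Y : SaturatedSystem P (paramT d η)) (S : Fin Y.m → Set (Pt d)) (hS : IsDissection P η Y S)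
    (hX : IsPoissonProcess μ η X) :
    μ.real (eventA P η Y S X)ᶜ ≤
      (2 * cardConst d + (d + 1) * (Real.exp 1 * d ^ d) * 2 ^ (d - 1)) *
        (flagCount P * (Real.log η ^ (4 * d ^ 2))⁻¹) := by
  set E₁ : Set Ω := ⋃ j, {ω | X ω ∩ Y.half j = ∅} with hE₁
  set E₂ : Set Ω := {ω | (X ω ∩ wetPart P (paramS d η)).Nonempty} with hE₂
  set E₃ : Set Ω := ⋃ j, {ω | ¬ ((X ω ∩ Y.bigCap (gam d) j).Finite ∧
    ((X ω ∩ Y.bigCap (gam d) j).ncard : ℝ) ≤ 3 * capMean d η)} with hE₃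
  have hcov : (eventA P η Y S X)ᶜ ⊆ E₁ ∪ (E₂ ∪ E₃) := by
    intro ω hω
    by_contra hno
    simp only [hE₁, hE₂, hE₃, mem_union, mem_iUnion, mem_ofPred_eq, not_or, not_exists,
      not_not] at hno
    obtain ⟨h1, h2, h3⟩ := hno
    refine hω ⟨fun j => nonempty_iff_ne_empty.2 (h1 j), not_nonempty_iff_eq_empty.1 h2,
      fun j => ?_⟩
    have hsub : X ω ∩ (S j ∩ wetPart P (paramTstar d η)) ⊆ X ω ∩ Y.bigCap (gam d) j :=
      inter_subset_inter_right _ (hS.wet_subset j)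
    refine ⟨(h3 j).1.subset hsub, ?_⟩
    have h4 : ((X ω ∩ (S j ∩ wetPart P (paramTstar d η))).ncard : ℝ) ≤
        (X ω ∩ Y.bigCap (gam d) j).ncard := by
      exact_mod_cast ncard_le_ncard hsub (h3 j).1
    refine h4.trans ((h3 j).2.trans_eq ?_)
    rw [capMean]; ring
  have hm := Y.card_le hd hP hV hK hc hη
  have hq : 0 < (Real.log η ^ betaExp d)⁻¹ := by
    have : 0 < Real.log η := by linarith [hη.one_le_log]
    positivity
  have hfam : ∀ E : Fin Y.m → Set Ω, (∀ j, μ.real (E j) ≤ (Real.log η ^ betaExp d)⁻¹) →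
      μ.real (⋃ j, E j) ≤ cardConst d * (flagCount P * (Real.log η ^ (4 * d ^ 2))⁻¹) := by
    intro E hE
    calc μ.real (⋃ j, E j) ≤ ∑ j, μ.real (E j) := measureReal_iUnion_fintype_le _
      _ ≤ ∑ _j : Fin Y.m, (Real.log η ^ betaExp d)⁻¹ := Finset.sum_le_sum fun j _ => hE j
      _ = Y.m * (Real.log η ^ betaExp d)⁻¹ := by simp
      _ ≤ cardConst d * (flagCount P * Real.log η ^ (d - 1)) * (Real.log η ^ betaExp d)⁻¹ := by
          gcongr
      _ = _ := by rw [← hη.log_pow_mul_inv]; ring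
  have b1 : μ.real E₁ ≤ _ := hfam _ fun j => measure_half_empty_le hd hV hK hc hη Y hX j
  have b2 : μ.real E₂ ≤ _ := measure_wetPart_nonempty_le hd hP hV hK hη hX
  have b3 : μ.real E₃ ≤ _ := hfam _ fun j => (hX.measure_count_gt_le
    (isClosed_cap hK _ _).measurableSet (volume_inter_ne_top hK _) (hη.capMean_nonneg hd)
    (Y.mean_bigCap_le hd hK hc hη j)).trans (hη.exp_neg_capMean_le hd)
  have h1 := measureReal_mono (μ := μ) hcov
  have h2 := measureReal_union_le (μ := μ) E₁ (E₂ ∪ E₃)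
  have h3 := measureReal_union_le (μ := μ) E₂ E₃
  linarith

end Event

end PoissonPolytope

end

theorem mainTheorem5 (d : ℕ) (hd : 2 ≤ d) :
    ∃ c₁ c₂ c₃ η₀ : ℝ, 0 < c₁ ∧ 0 < c₂ ∧ 0 < c₃ ∧ 1 < η₀ ∧
      ∀ (P : Set (PoissonPolytope.Pt d)), PoissonPolytope.IsPolytope P →
        MeasureTheory.volume P = 1 →
      ∀ (η : ℝ), η₀ ≤ η →
      ∀ (Y : PoissonPolytope.SaturatedSystem P (PoissonPolytope.paramT d η))
        (S : Fin Y.m → Set (PoissonPolytope.Pt d)), PoissonPolytope.IsDissection P η Y S →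
      ∀ (Ω : Type*) [MeasurableSpace Ω] (μ : MeasureTheory.Measure Ω)
        [MeasureTheory.IsProbabilityMeasure μ] (X : Ω → Set (PoissonPolytope.Pt d)),
        PoissonPolytope.IsPoissonProcess μ η X →
      c₁ * (Real.log η ^ ((3 * d) ^ (d + 2)))⁻¹ ≤ μ.real (PoissonPolytope.eventA P η Y S X)ᶜ ∧
      μ.real (PoissonPolytope.eventA P η Y S X)ᶜ ≤
        c₂ * (PoissonPolytope.flagCount P * (Real.log η ^ (4 * d ^ 2))⁻¹) ∧
      ∀ ω ∈ PoissonPolytope.eventA P η Y S X,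
        PoissonPolytope.floatingBody P (PoissonPolytope.paramTstar d η) ⊆
          convexHull ℝ (X ω ∩ P) ∧
        convexHull ℝ (X ω ∩ P) ⊆
          PoissonPolytope.floatingBody P (PoissonPolytope.paramS d η) ∧
        (PoissonPolytope.wetPart P (PoissonPolytope.paramTstar d η) ∩ X ω).Finite ∧
        ((PoissonPolytope.wetPart P (PoissonPolytope.paramTstar d η) ∩ X ω).ncard : ℝ) ≤
          c₃ * (PoissonPolytope.flagCount P *
            (Real.log η ^ (d - 1) * Real.log (Real.log η))) := by
  have hd0 : 0 < d := by omega
  have hdR : (0 : ℝ) < d := by exact_mod_cast hd0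
  obtain ⟨η₁, hη₁⟩ := Filter.eventually_atTop.1 (PoissonPolytope.eventually_isLarge d)
  have hcard : 0 < PoissonPolytope.cardConst d := by
    rw [PoissonPolytope.cardConst]; positivity
  have hgam : 0 < PoissonPolytope.gam d := by linarith [PoissonPolytope.one_le_gam hd0]
  have halpha : 0 < PoissonPolytope.alpha d := by
    linarith [PoissonPolytope.one_le_betaExp hd0, PoissonPolytope.betaExp_le_alpha hd0]
  refine ⟨1 / 2, 2 * PoissonPolytope.cardConst d + (d + 1) * (Real.exp 1 * d ^ d) * 2 ^ (d - 1),
    3 * ((6 * PoissonPolytope.gam d) ^ d * PoissonPolytope.alpha d) *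
      PoissonPolytope.cardConst d, max η₁ 2, by norm_num, by positivity, by positivity,
    lt_max_of_lt_right one_lt_two, ?_⟩
  intro P hP hV η hη Y S hS Ω _ μ _ X hX
  have hL := hη₁ η ((le_max_left _ _).trans hη)
  have hKc : IsCompact P ∧ Convex ℝ P := by
    obtain ⟨V, hVfin, rfl⟩ := hP
    exact ⟨hVfin.isCompact_convexHull ℝ, convex_convexHull ℝ V⟩
  obtain ⟨hK, hc⟩ := hKc
  refine ⟨PoissonPolytope.le_measure_compl_eventA hd0 hV hK hL Y S hX,
    PoissonPolytope.measure_compl_eventA_le hd0 hP hV hK hc hL Y S hS hX, fun ω hω => ?_⟩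
  refine ⟨?_, ?_, PoissonPolytope.wetPart_inter_finite_and_card_le hd0 hP hV hK hc hL Y S hS hω⟩
  · refine Y.floatingBody_subset_convexHull hd hK hc (hL.paramT_pos hd0) ?_ hω.1
    rw [MeasureTheory.measureReal_def, hV, ENNReal.toReal_one]
    exact hL.paramT_lt
  · refine convexHull_min ?_ (PoissonPolytope.convex_floatingBody hd0 hc _)
    rintro x ⟨hxX, hxP⟩
    refine ⟨hxP, ?_⟩
    by_contra! hlt
    have : x ∈ X ω ∩ PoissonPolytope.wetPart P (PoissonPolytope.paramS d η) :=
      ⟨hxX, hxP, hlt.le⟩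
    rw [hω.2.1] at this
    exact this
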